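/- Let $\mathcal Y$ be the space of all vector fields $A\in L^3(\mathbb R^3,\mathbb R^3)$ whose distributional curl $\nabla\wedge A$ belongs to $L^{3/2}(\mathbb R^3,\mathbb R^3)$. For $A\in\mathcal Y$ put $$ |\!|\!| A |\!|\!|_3 := \inf_{\phi\in\dot W^{1,3}(\mathbb R^3)} \|A-\nabla\phi\|_{L^3}, $$ where $\dot W^{1,3}(\mathbb R^3)$ is the space of all real functions $\phi\in L^1_{\rm loc}(\mathbb R^3)$ whose distributional gradient satisfies $\nabla\phi\in L^3(\mathbb R^3,\mathbb R^3)$. For $t>0$ let $e^{t\Delta}$ be the heat semigroup, $(e^{t\Delta}B)(x)=(4\pi t)^{-3/2}\int_{\mathbb R^3} e^{-|x-y|^2/(4t)}B(y)\,dy$. Then there is a universal constant $C<\infty$ such that for every $A\in\mathcal Y$ $$ |\!|\!| A |\!|\!|_3 \le C\, \|\nabla\wedge A\|_{L^{3/2}}^{1/2} \Bigl( \sup_{t>0} t\, \|e^{t\Delta}(\nabla\wedge A)\|_{L^\infty(\mathbb R^3,\mathbb R^3)} \Bigr)^{1/2}. $$ -/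

import Mathlib

open MeasureTheory
open scoped ENNReal NNReal ContDiff

/-- Three-dimensional Euclidean space. -/
abbrev R3 : Type := EuclideanSpace ℝ (Fin 3)

/-- The partial derivative `∂ᵢ ψ`. -/
noncomputable def partialDeriv (i : Fin 3) (ψ : R3 → ℝ) (x : R3) : ℝ :=
  fderiv ℝ ψ x (EuclideanSpace.single i 1)

/-- Real-valued test functions: smooth with compact support. -/
def IsTestFunction (ψ : R3 → ℝ) : Prop :=
  ContDiff ℝ ∞ ψ ∧ HasCompactSupport ψ

/-- The locally integrable field `G` is the distributional gradient of `φ ∈ L¹_loc`. -/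
def HasWeakGradient (φ : R3 → ℝ) (G : R3 → R3) : Prop :=
  LocallyIntegrable φ volume ∧ LocallyIntegrable G volume ∧
    ∀ ψ : R3 → ℝ, IsTestFunction ψ → ∀ i : Fin 3,
      ∫ x, G x i * ψ x = - ∫ x, φ x * partialDeriv i ψ x

/-- The locally integrable field `B` is the distributional curl of `A ∈ L¹_loc`, that is,
`Bᵢ = ∂ᵢ₊₁ Aᵢ₊₂ - ∂ᵢ₊₂ Aᵢ₊₁` in the sense of distributions, with indices modulo 3. -/
def HasWeakCurl (A B : R3 → R3) : Prop :=
  LocallyIntegrable A volume ∧ LocallyIntegrable B volume ∧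
    ∀ ψ : R3 → ℝ, IsTestFunction ψ → ∀ i : Fin 3,
      ∫ x, B x i * ψ x =
        - ∫ x, (A x (i + 2) * partialDeriv (i + 1) ψ x
          - A x (i + 1) * partialDeriv (i + 2) ψ x)

/-- The vector fields in `L³` whose distributional curl is in `L^{3/2}`. -/
def spaceY : Set (R3 → R3) :=
  {A | MemLp A 3 volume ∧ ∃ B : R3 → R3, MemLp B (3 / 2) volume ∧ HasWeakCurl A B}

/-- The infimum of `‖A - ∇φ‖₃` over all real `φ ∈ L¹_loc` with `∇φ ∈ L³`. -/
noncomputable def gaugeL3Seminorm (A : R3 → R3) : ℝ≥0∞ :=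
  ⨅ (φ : R3 → ℝ) (G : R3 → R3) (_ : HasWeakGradient φ G) (_ : MemLp G 3 volume),
    eLpNorm (fun x => A x - G x) 3 volume

/-- The heat semigroup `e^{tΔ}`, `t > 0`, as convolution with the Gaussian kernel. -/
noncomputable def heatSemigroup (t : ℝ) (B : R3 → R3) (x : R3) : R3 :=
  ∫ y, ((4 * Real.pi * t) ^ (-(3 / 2) : ℝ) * Real.exp (-‖x - y‖ ^ 2 / (4 * t))) • B y

/-- `sup_{t > 0} t ‖e^{tΔ} B‖_∞`. -/
noncomputable def heatBesovNorm (B : R3 → R3) : ℝ≥0∞ :=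
  ⨆ (t : ℝ) (_ : 0 < t), ENNReal.ofReal t * eLpNorm (heatSemigroup t B) ∞ volume

/-!
Write `A = (A - e^{εΔ} A) + e^{TΔ} A + (e^{εΔ} A - e^{TΔ} A)`. Since `∂ₜ e^{tΔ} = Δ e^{tΔ}` and
`-Δ = ∇∧∇∧ - ∇(∇·)`, the last difference is a gradient plus `U = ∫ ∇ ∧ e^{tΔ} B dt` over
`ε ≤ t ≤ T`, which depends only on `B = ∇ ∧ A`. With `M` the Hardy-Littlewood maximal function and
`K = sup_s s ‖e^{sΔ} B‖_∞`, the integrand is at most a constant times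
`min (t^{-1/2} M B, t^{-3/2} K)`; splitting the integral at `t = K / M B`, as in Hedberg's
inequality, gives `|U| ≤ C (M B · K)^{1/2}` pointwise, uniformly in `ε` and `T`. The maximal
inequality in `L^{3/2}` then bounds `‖U‖₃` by `C (‖B‖_{3/2} K)^{1/2}`, while `A - e^{εΔ} A` and
`e^{TΔ} A` tend to zero in `L³` as `ε → 0` and `T → ∞`.
-/

open Metric Set Filter Topology
open scoped Convolution
open ContinuousLinearMap (lsmul)

lemma setLIntegral_Ioi_rpow {q : ℝ} (hq : 0 < q) (c : ℝ≥0∞) :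
    ∫⁻ t in Ioi 0 ∩ {t : ℝ | ENNReal.ofReal t < c}, ENNReal.ofReal (q * t ^ (q - 1)) = c ^ q := by
  have hfin (b : ℝ≥0) : ∫⁻ t in Ioi 0 ∩ {t : ℝ | ENNReal.ofReal t < b},
      ENNReal.ofReal (q * t ^ (q - 1)) = (b : ℝ≥0∞) ^ q := by
    have hset : Ioi 0 ∩ {t : ℝ | ENNReal.ofReal t < b} = Ioo 0 (b : ℝ) := by
      ext t
      simp only [mem_inter_iff, mem_Ioi, mem_ofPred_eq, mem_Ioo]
      refine and_congr_right fun ht => ?_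
      rw [← ENNReal.ofReal_coe_nnreal, ENNReal.ofReal_lt_ofReal_iff_of_nonneg ht.le]
    have hint : IntegrableOn (fun t : ℝ => q * t ^ (q - 1)) (Ioc 0 (b : ℝ)) :=
      (intervalIntegrable_iff_integrableOn_Ioc_of_le b.2).1
        ((intervalIntegral.intervalIntegrable_rpow' (by linarith)).const_mul q)
    rw [hset, restrict_Ioo_eq_restrict_Ioc, ← ofReal_integral_eq_lintegral_ofReal hint
      ((ae_restrict_mem measurableSet_Ioc).mono fun t ht =>
        mul_nonneg hq.le (Real.rpow_nonneg ht.1.le _)),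
      ← intervalIntegral.integral_of_le b.coe_nonneg, intervalIntegral.integral_const_mul,
      integral_rpow (.inl (by linarith)), sub_add_cancel, Real.zero_rpow hq.ne', sub_zero,
      mul_div_cancel₀ _ hq.ne', ← ENNReal.ofReal_rpow_of_nonneg b.coe_nonneg hq.le]
    simp
  rcases eq_or_ne c ⊤ with rfl | hc
  · rw [ENNReal.top_rpow_of_pos hq]
    refine ENNReal.eq_top_of_forall_nnreal_le fun b => ?_
    calc (b : ℝ≥0∞) = ((b ^ q⁻¹ : ℝ≥0) : ℝ≥0∞) ^ q := by
          rw [← ENNReal.coe_rpow_of_nonneg _ hq.le, NNReal.rpow_inv_rpow hq.ne']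
      _ ≤ _ := (hfin _).symm.trans_le (lintegral_mono_set
          (inter_subset_inter_right _ fun t ht => ht.trans ENNReal.coe_lt_top))
  · lift c to ℝ≥0 using hc
    exact hfin c

lemma lintegral_rpow_eq_setLIntegral_Ioi {X : Type*} [MeasurableSpace X] (ν : Measure X)
    [SFinite ν] {f : X → ℝ≥0∞} (hf : Measurable f) {q : ℝ} (hq : 0 < q) :
    ∫⁻ x, f x ^ q ∂ν =
      ∫⁻ t in Ioi 0, ENNReal.ofReal (q * t ^ (q - 1)) * ν {x | ENNReal.ofReal t < f x} := by
  have hm (x : X) : MeasurableSet {t : ℝ | ENNReal.ofReal t < f x} :=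
    measurableSet_lt (by fun_prop) measurable_const
  have hm' : MeasurableSet {z : X × ℝ | ENNReal.ofReal z.2 < f z.1} :=
    measurableSet_lt (by fun_prop) (by fun_prop)
  let F (x : X) (t : ℝ) : ℝ≥0∞ := {z : X × ℝ | ENNReal.ofReal z.2 < f z.1}.indicator
    (fun z => ENNReal.ofReal (q * z.2 ^ (q - 1))) (x, t)
  have hF : Measurable (Function.uncurry F) := Measurable.indicator (by fun_prop) hm'
  calc ∫⁻ x, f x ^ q ∂ν = ∫⁻ x, (∫⁻ t in Ioi 0, F x t) ∂ν := by
        refine lintegral_congr fun x => ?_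
        rw [← setLIntegral_Ioi_rpow hq, inter_comm, ← Measure.restrict_restrict (hm x),
          ← lintegral_indicator (hm x)]
        rfl
    _ = ∫⁻ t in Ioi 0, ∫⁻ x, F x t ∂ν := lintegral_lintegral_swap hF.aemeasurable
    _ = _ := by
        refine lintegral_congr fun t => ?_
        rw [← lintegral_indicator_const (measurableSet_lt measurable_const hf)]
        rfl

section MaximalFunction

variable {E : Type*} [NormedAddCommGroup E] [MeasurableSpace E]

/-- The centred Hardy–Littlewood maximal function of `f` with respect to `μ`. -/
noncomputable def maximalFunction (μ : Measure E) (f : E → ℝ≥0∞) (x : E) : ℝ≥0∞ :=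
  ⨆ (r : ℝ) (_ : 0 < r), ⨍⁻ y in ball x r, f y ∂μ

variable {μ : Measure E} {f g : E → ℝ≥0∞}

lemma maximalFunction_congr_ae (h : f =ᵐ[μ] g) : maximalFunction μ f = maximalFunction μ g := by
  funext x
  simp only [maximalFunction, setLAverage_eq, lintegral_congr_ae (ae_restrict_of_ae h)]

lemma lowerSemicontinuous_setLIntegral_ball [OpensMeasurableSpace E] (hf : Measurable f) (r : ℝ) :
    LowerSemicontinuous fun x => ∫⁻ y in ball x r, f y ∂μ := by
  have hball (y : E) : LowerSemicontinuous fun x => (ball x r).indicator f y := by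
    have : (fun x => (ball x r).indicator f y) = (ball y r).indicator fun _ => f y := by
      ext x
      simp only [indicator, mem_ball, dist_comm]
    exact this ▸ isOpen_ball.lowerSemicontinuous_indicator zero_le
  refine lowerSemicontinuous_iff_le_liminf.2 fun x => ?_
  simp_rw [← lintegral_indicator measurableSet_ball]
  exact (lintegral_mono fun y => lowerSemicontinuous_iff_le_liminf.1 (hball y) x).trans
    (lintegral_liminf_le fun x' => hf.indicator measurableSet_ball)

lemma measurable_maximalFunction [BorelSpace E] [μ.IsAddHaarMeasure]
    (hf : AEMeasurable f μ) : Measurable (maximalFunction μ f) := by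
  rw [maximalFunction_congr_ae hf.ae_eq_mk]
  refine (lowerSemicontinuous_biSup fun r hr => ?_).measurable
  simp_rw [setLAverage_eq, Measure.addHaar_ball_center μ _ r]
  exact (ENNReal.continuous_div_const _ (measure_ball_pos μ 0 hr).ne').comp_lowerSemicontinuous
    (lowerSemicontinuous_setLIntegral_ball hf.measurable_mk r)
    fun _ _ h => ENNReal.div_le_div_right h _

variable [NormedSpace ℝ E] [FiniteDimensional ℝ E] [μ.IsAddHaarMeasure]

lemma setLIntegral_ball_le_maximalFunction_mul (f : E → ℝ≥0∞) (x : E) {r : ℝ} (hr : 0 < r) :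
    ∫⁻ y in ball x r, f y ∂μ ≤ maximalFunction μ f x * μ (ball x r) := by
  rw [← ENNReal.div_le_iff (measure_ball_pos μ x hr).ne' measure_ball_lt_top.ne,
    ← setLAverage_eq]
  exact le_iSup₂_of_le r hr le_rfl

lemma maximalFunction_le_add_indicator (f : E → ℝ≥0∞) (b : ℝ≥0∞) (x : E) :
    maximalFunction μ f x ≤ b + maximalFunction μ ({y | b < f y}.indicator f) x := by
  refine iSup₂_le fun r hr => ?_
  rw [setLAverage_eq, ENNReal.div_le_iff (measure_ball_pos μ x hr).ne' measure_ball_lt_top.ne,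
    add_mul]
  calc ∫⁻ y in ball x r, f y ∂μ ≤ ∫⁻ y in ball x r, (b + {y | b < f y}.indicator f y) ∂μ := by
        refine lintegral_mono fun y => ?_
        by_cases hy : b < f y
        · simp [hy]
        · exact (not_lt.1 hy).trans le_self_add
    _ = b * μ (ball x r) + ∫⁻ y in ball x r, {y | b < f y}.indicator f y ∂μ := by
        rw [lintegral_add_left measurable_const, setLIntegral_const]
    _ ≤ _ := by gcongr; exact setLIntegral_ball_le_maximalFunction_mul _ x hr

lemma exists_ball_of_lt_maximalFunction {x : E} {a : ℝ≥0∞} (hx : a < maximalFunction μ f x) :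
    ∃ r > 0, a * μ (ball x r) ≤ ∫⁻ y in ball x r, f y ∂μ := by
  obtain ⟨r, hr, hlt⟩ : ∃ r > 0, a < ⨍⁻ y in ball x r, f y ∂μ := by
    simpa only [maximalFunction, lt_iSup_iff, exists_prop] using hx
  rw [setLAverage_eq] at hlt
  exact ⟨r, hr, (ENNReal.le_div_iff_mul_le (.inl (measure_ball_pos μ x hr).ne')
    (.inl measure_ball_lt_top.ne)).1 hlt.le⟩

variable [BorelSpace E]

lemma exists_radius_le_of_measure_ball_le [Nontrivial E] {c : ℝ≥0∞} (hc : c ≠ ⊤) :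
    ∃ R : ℝ, ∀ (x : E) (r : ℝ), μ (ball x r) ≤ c → r ≤ R := by
  have := NormedSpace.noncompactSpace ℝ E
  have hlim : Tendsto (fun n : ℕ => μ (ball (0 : E) n)) atTop (𝓝 ⊤) := by
    rw [← measure_univ_of_isAddLeftInvariant μ, ← iUnion_ball_nat (0 : E)]
    exact tendsto_measure_iUnion_atTop fun m n hmn => ball_subset_ball (by exact_mod_cast hmn)
  obtain ⟨n, hn⟩ := (hlim.eventually_const_lt hc.lt_top).exists
  refine ⟨n, fun x r hr => not_lt.1 fun hlt => hn.not_ge ?_⟩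
  calc μ (ball 0 (n : ℝ)) ≤ μ (ball 0 r) := measure_mono (ball_subset_ball hlt.le)
    _ = μ (ball x r) := (Measure.addHaar_ball_center μ x r).symm
    _ ≤ c := hr

lemma addHaar_le_of_forall_exists_ball [Nontrivial E] {ν : Measure E} {s : Set E} {a : ℝ≥0∞}
    (ha : a ≠ 0) (ha' : a ≠ ⊤)
    (h : ∀ x ∈ s, ∃ r > 0, a * μ (ball x r) ≤ ν (ball x r)) :
    μ s ≤ 4 ^ Module.finrank ℝ E / a * ν univ := by
  rcases eq_or_ne (ν univ) ⊤ with hν | hν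
  · simp [hν, ENNReal.mul_top, ENNReal.div_eq_zero_iff, ha']
  choose! r hr hle using h
  have hle' (x) (hx : x ∈ s) : μ (ball x (r x)) ≤ ν (ball x (r x)) / a := by
    rw [ENNReal.le_div_iff_mul_le (.inl ha) (.inl ha'), mul_comm]
    exact hle x hx
  obtain ⟨R, hR⟩ := exists_radius_le_of_measure_ball_le (μ := μ) (ENNReal.div_ne_top hν ha)
  obtain ⟨u, hus, hdisj, hcov⟩ : ∃ u ⊆ s, (u.PairwiseDisjoint fun x => ball x (r x)) ∧
      ∀ x ∈ s, ∃ y ∈ u, ball x (r x) ⊆ ball y (4 * r y) :=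
    Vitali.exists_disjoint_subfamily_covering_enlargement_ball s id r R (fun x hx => hR x (r x)
      ((hle' x hx).trans (ENNReal.div_le_div_right (measure_mono (subset_univ _)) a))) 4
      (by norm_num)
  have hu : u.Countable := hdisj.countable_of_isOpen (fun _ _ => isOpen_ball)
    fun x hx => ⟨x, mem_ball_self (hr x (hus hx))⟩
  have hsub : s ⊆ ⋃ x ∈ u, ball x (4 * r x) := fun x hx =>
    let ⟨y, hy, hxy⟩ := hcov x hx
    mem_biUnion hy (hxy (mem_ball_self (hr x hx)))
  calc μ s ≤ ∑' x : u, μ (ball (x : E) (4 * r x)) :=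
        (measure_mono hsub).trans (measure_biUnion_le μ hu _)
    _ ≤ ∑' x : u, 4 ^ Module.finrank ℝ E / a * ν (ball x (r x)) := by
        refine ENNReal.tsum_le_tsum fun x => ?_
        rw [Measure.addHaar_ball_mul_of_pos μ _ (by norm_num),
          ← Measure.addHaar_ball_center μ (x : E), ENNReal.ofReal_pow (by norm_num),
          ENNReal.ofReal_ofNat, ENNReal.mul_comm_div]
        gcongr
        exact hle' x (hus x.2)
    _ = 4 ^ Module.finrank ℝ E / a * ν (⋃ x ∈ u, ball x (r x)) := by
        rw [ENNReal.tsum_mul_left, measure_biUnion hu hdisj fun _ _ => measurableSet_ball]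
    _ ≤ _ := by gcongr; exact subset_univ _

lemma measure_lt_maximalFunction_le [Nontrivial E] (f : E → ℝ≥0∞) {a : ℝ≥0∞} (ha : a ≠ 0)
    (ha' : a ≠ ⊤) :
    μ {x | a < maximalFunction μ f x} ≤ 4 ^ Module.finrank ℝ E / a * ∫⁻ x, f x ∂μ := by
  rw [← setLIntegral_univ, ← withDensity_apply f MeasurableSet.univ]
  refine addHaar_le_of_forall_exists_ball ha ha' fun x hx => ?_
  simpa only [withDensity_apply f measurableSet_ball] using exists_ball_of_lt_maximalFunction hx

lemma measure_lt_maximalFunction_le_withDensity [Nontrivial E] (hf : Measurable f) {a : ℝ≥0∞}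
    (ha : a ≠ 0) (ha' : a ≠ ⊤) :
    μ {x | a < maximalFunction μ f x} ≤
      2 * 4 ^ Module.finrank ℝ E / a * μ.withDensity f {x | a < 2 * f x} := by
  have hlt (x : E) : a < 2 * f x ↔ a / 2 < f x := by
    rw [ENNReal.div_lt_iff (by simp) (by simp), mul_comm]
  have hm : MeasurableSet {x | a / 2 < f x} := measurableSet_lt measurable_const hf
  have hsub : {x | a < maximalFunction μ f x} ⊆
      {x | a / 2 < maximalFunction μ ({y | a / 2 < f y}.indicator f) x} := fun x hx => by
    rw [mem_ofPred_eq, ← ENNReal.add_halves a] at hx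
    exact lt_of_add_lt_add_left (hx.trans_le (maximalFunction_le_add_indicator f (a / 2) x))
  simp_rw [hlt]
  rw [withDensity_apply f hm, ← lintegral_indicator hm]
  refine (measure_mono hsub).trans ((measure_lt_maximalFunction_le _
    (ENNReal.div_ne_zero.2 ⟨ha, by simp⟩) (ENNReal.div_ne_top ha' (by simp))).trans_eq ?_)
  rw [div_eq_mul_inv _ (a / 2), ENNReal.inv_div (by simp) (by simp), mul_comm 2, mul_div_assoc]

lemma ofReal_mul_measure_lt_maximalFunction_le [Nontrivial E] (hf : Measurable f) {p t : ℝ}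
    (hp : 1 < p) (ht : 0 < t) :
    ENNReal.ofReal (p * t ^ (p - 1)) * μ {x | ENNReal.ofReal t < maximalFunction μ f x} ≤
      2 * 4 ^ Module.finrank ℝ E * ENNReal.ofReal (p / (p - 1)) *
        (ENNReal.ofReal ((p - 1) * t ^ (p - 1 - 1)) *
          μ.withDensity f {x | ENNReal.ofReal t < 2 * f x}) := by
  have hp' : 0 < p - 1 := by linarith
  have hpow : p * t ^ (p - 1) = p / (p - 1) * ((p - 1) * t ^ (p - 1 - 1)) * t := by
    rw [← mul_assoc, div_mul_cancel₀ _ hp'.ne', mul_assoc, ← Real.rpow_add_one ht.ne',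
      sub_add_cancel]
  have ht' : ENNReal.ofReal t ≠ 0 := (ENNReal.ofReal_pos.2 ht).ne'
  rw [hpow, ENNReal.ofReal_mul' ht.le, ENNReal.ofReal_mul (by positivity)]
  set D := μ.withDensity f {x | ENNReal.ofReal t < 2 * f x}
  calc _ ≤ _ := mul_le_mul_right
        (measure_lt_maximalFunction_le_withDensity hf ht' ENNReal.ofReal_ne_top) _
    _ = 2 * 4 ^ Module.finrank ℝ E * ENNReal.ofReal (p / (p - 1)) *
        (ENNReal.ofReal ((p - 1) * t ^ (p - 1 - 1)) * D) *
        (ENNReal.ofReal t * (ENNReal.ofReal t)⁻¹) := by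
        rw [div_eq_mul_inv _ (ENNReal.ofReal t)]
        ring
    _ = _ := by rw [ENNReal.mul_inv_cancel ht' ENNReal.ofReal_ne_top, mul_one]

lemma exists_lintegral_maximalFunction_rpow_le [Nontrivial E] (μ : Measure E)
    [μ.IsAddHaarMeasure] {p : ℝ} (hp : 1 < p) :
    ∃ C : ℝ≥0, ∀ f : E → ℝ≥0∞, AEMeasurable f μ →
      ∫⁻ x, maximalFunction μ f x ^ p ∂μ ≤ C * ∫⁻ x, f x ^ p ∂μ := by
  set K : ℝ≥0∞ := 2 * 4 ^ Module.finrank ℝ E * ENNReal.ofReal (p / (p - 1))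
  refine ⟨(K * 2 ^ (p - 1)).toNNReal, fun f hf => ?_⟩
  wlog hf' : Measurable f generalizing f
  · rw [maximalFunction_congr_ae hf.ae_eq_mk,
      lintegral_congr_ae (hf.ae_eq_mk.mono fun x hx => congrArg (· ^ p) hx)]
    exact this _ hf.measurable_mk.aemeasurable hf.measurable_mk
  have hp' : 0 < p - 1 := by linarith
  calc ∫⁻ x, maximalFunction μ f x ^ p ∂μ = ∫⁻ t in Ioi 0, ENNReal.ofReal (p * t ^ (p - 1)) *
        μ {x | ENNReal.ofReal t < maximalFunction μ f x} :=
        lintegral_rpow_eq_setLIntegral_Ioi μ (measurable_maximalFunction hf) (by linarith)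
    _ ≤ ∫⁻ t in Ioi 0, K * (ENNReal.ofReal ((p - 1) * t ^ (p - 1 - 1)) *
        μ.withDensity f {x | ENNReal.ofReal t < 2 * f x}) :=
        setLIntegral_mono' measurableSet_Ioi fun t ht =>
          ofReal_mul_measure_lt_maximalFunction_le hf' hp ht
    _ = K * ∫⁻ x, (2 * f x) ^ (p - 1) ∂μ.withDensity f := by
        rw [lintegral_const_mul' _ _ (by simp only [K]; finiteness),
          lintegral_rpow_eq_setLIntegral_Ioi _ (by fun_prop) hp']
    _ = K * ∫⁻ x, 2 ^ (p - 1) * f x ^ p ∂μ := by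
        rw [lintegral_withDensity_eq_lintegral_mul _ hf' (by fun_prop)]
        congr 1
        refine lintegral_congr fun x => ?_
        rw [Pi.mul_apply, ENNReal.mul_rpow_of_nonneg _ _ hp'.le, mul_left_comm,
          ← add_sub_cancel 1 p, ENNReal.rpow_add_of_nonneg 1 _ zero_le_one hp'.le,
          ENNReal.rpow_one, add_sub_cancel]
    _ = _ := by
        rw [lintegral_const_mul' _ _ (by finiteness), ← mul_assoc, ENNReal.coe_toNNReal
          (by simp only [K]; finiteness)]

lemma lintegral_mul_le_maximalFunction_mul (hf : AEMeasurable f μ) {k : E → ℝ}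
    (hk : Measurable k) (hk0 : 0 ≤ k) {x : E} (hball : ∀ t > 0, ∃ r, {y | t < k y} = ball x r) :
    ∫⁻ y, f y * ENNReal.ofReal (k y) ∂μ ≤
      maximalFunction μ f x * ∫⁻ y, ENNReal.ofReal (k y) ∂μ := by
  have hlevel : ∀ t ∈ Ioi (0 : ℝ), μ.withDensity f {y | t < k y} ≤
      maximalFunction μ f x * μ {y | t < k y} := fun t ht => by
    obtain ⟨r, hr⟩ := hball t ht
    rw [hr, withDensity_apply f measurableSet_ball]
    rcases le_or_gt r 0 with hr0 | hr0
    · simp [ball_eq_empty.2 hr0]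
    · exact setLIntegral_ball_le_maximalFunction_mul f x hr0
  have hanti : Antitone fun t => μ {y | t < k y} := fun s t hst =>
    measure_mono fun y hy => hst.trans_lt hy
  calc ∫⁻ y, f y * ENNReal.ofReal (k y) ∂μ
      = ∫⁻ y, ENNReal.ofReal (k y) ∂μ.withDensity f :=
        (lintegral_withDensity_eq_lintegral_mul₀ hf (by fun_prop)).symm
    _ = ∫⁻ t in Ioi 0, μ.withDensity f {y | t < k y} :=
        lintegral_eq_lintegral_meas_lt _ (ae_of_all _ hk0) hk.aemeasurable
    _ ≤ ∫⁻ t in Ioi 0, maximalFunction μ f x * μ {y | t < k y} :=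
        setLIntegral_mono' measurableSet_Ioi hlevel
    _ = _ := by
        rw [lintegral_const_mul _ hanti.measurable,
          lintegral_eq_lintegral_meas_lt _ (ae_of_all _ hk0) hk.aemeasurable]

end MaximalFunction

section Convolution

lemma lintegral_mul_rpow_le {α : Type*} [MeasurableSpace α] {μ : Measure α} {p : ℝ} (hp : 1 ≤ p)
    {k h : α → ℝ≥0∞} (hk : AEMeasurable k μ) (hh : AEMeasurable h μ) :
    (∫⁻ y, k y * h y ∂μ) ^ p ≤ (∫⁻ y, k y ∂μ) ^ (p - 1) * ∫⁻ y, k y * h y ^ p ∂μ := by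
  have hp0 : 0 < p := one_pos.trans_le hp
  have hHolder := eLpNorm'_le_eLpNorm'_mul_rpow_measure_univ one_pos hp
    (hh.mono' (withDensity_absolutelyContinuous μ k)).aestronglyMeasurable
  simp only [eLpNorm', enorm_eq_self, ENNReal.rpow_one, div_one] at hHolder
  rw [withDensity_apply _ .univ, Measure.restrict_univ,
    lintegral_withDensity_eq_lintegral_mul₀ hk hh,
    lintegral_withDensity_eq_lintegral_mul₀ hk (hh.pow_const p)] at hHolder
  calc (∫⁻ y, k y * h y ∂μ) ^ p
      ≤ ((∫⁻ y, k y * h y ^ p ∂μ) ^ (1 / p) * (∫⁻ y, k y ∂μ) ^ (1 - 1 / p)) ^ p :=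
        ENNReal.rpow_le_rpow hHolder hp0.le
    _ = _ := by
        rw [ENNReal.mul_rpow_of_nonneg _ _ hp0.le, ← ENNReal.rpow_mul, ← ENNReal.rpow_mul,
          one_div_mul_cancel hp0.ne', ENNReal.rpow_one, sub_mul, one_mul,
          one_div_mul_cancel hp0.ne', mul_comm]

lemma lintegral_lintegral_mul_rpow_le {X Y : Type*} [MeasurableSpace X] [MeasurableSpace Y]
    {μ : Measure X} {ν : Measure Y} [SFinite μ] [SFinite ν] {p : ℝ} (hp : 1 ≤ p)
    {k : Y → ℝ≥0∞} (hk : AEMeasurable k ν) {H : X → Y → ℝ≥0∞}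
    (hH : AEMeasurable (Function.uncurry H) (μ.prod ν)) :
    ∫⁻ x, (∫⁻ y, k y * H x y ∂ν) ^ p ∂μ ≤
      (∫⁻ y, k y ∂ν) ^ (p - 1) * ∫⁻ y, k y * ∫⁻ x, H x y ^ p ∂μ ∂ν := by
  have hsection_left : ∀ᵐ x ∂μ, AEMeasurable (H x) ν :=
    hH.aestronglyMeasurable.prodMk_left.mono fun x hx => hx.aemeasurable
  have hsection_right : ∀ᵐ y ∂ν, AEMeasurable (fun x => H x y) μ :=
    hH.prod_swap.aestronglyMeasurable.prodMk_left.mono fun y hy => hy.aemeasurable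
  have hprod : AEMeasurable (Function.uncurry fun x y => k y * H x y ^ p) (μ.prod ν) :=
    hk.comp_snd.mul (hH.pow_const _)
  calc ∫⁻ x, (∫⁻ y, k y * H x y ∂ν) ^ p ∂μ
      ≤ ∫⁻ x, (∫⁻ y, k y ∂ν) ^ (p - 1) * ∫⁻ y, k y * H x y ^ p ∂ν ∂μ :=
        lintegral_mono_ae (hsection_left.mono fun x hx => lintegral_mul_rpow_le hp hk hx)
    _ = (∫⁻ y, k y ∂ν) ^ (p - 1) * ∫⁻ y, ∫⁻ x, k y * H x y ^ p ∂μ ∂ν := by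
        rw [← lintegral_lintegral_swap hprod]
        exact lintegral_const_mul'' _ hprod.lintegral_prod_right'
    _ = _ := by
        congr 1
        exact lintegral_congr_ae (hsection_right.mono fun y hy =>
          lintegral_const_mul'' _ (hy.pow_const _))

lemma eLpNorm_rpow_toReal {α F : Type*} [MeasurableSpace α] [NormedAddCommGroup F]
    {μ : Measure α} {p : ℝ≥0∞} (hp0 : p ≠ 0) (hp : p ≠ ⊤) (f : α → F) :
    eLpNorm f p μ ^ p.toReal = ∫⁻ x, ‖f x‖ₑ ^ p.toReal ∂μ := by
  rw [eLpNorm_eq_lintegral_rpow_enorm_toReal hp0 hp, ← ENNReal.rpow_mul,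
    one_div_mul_cancel (ENNReal.toReal_pos hp0 hp).ne', ENNReal.rpow_one]

variable {E F : Type*} [NormedAddCommGroup E] [MeasurableSpace E] [BorelSpace E]
  [NormedAddCommGroup F] {μ : Measure E} [μ.IsAddHaarMeasure] {p : ℝ≥0∞} {f : E → F}

lemma eLpNorm_sub_translate_le (hp : 1 ≤ p) (hf : AEStronglyMeasurable f μ) (y : E) :
    eLpNorm (fun x => f x - f (x - y)) p μ ≤ 2 * eLpNorm f p μ := by
  have hτ := measurePreserving_sub_right μ y
  refine (eLpNorm_sub_le hf (hf.comp_measurePreserving hτ) hp).trans_eq ?_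
  rw [eLpNorm_comp_measurePreserving hf hτ, two_mul]

variable [ProperSpace E]

lemma aestronglyMeasurable_comp_sub (hf : AEStronglyMeasurable f μ) :
    AEStronglyMeasurable (fun q : E × E => f (q.1 - q.2)) (μ.prod μ) :=
  hf.comp_quasiMeasurePreserving (quasiMeasurePreserving_sub_of_right_invariant μ μ)

lemma memLp_comp_sub_left (hf : MemLp f p μ) (x : E) : MemLp (fun y => f (x - y)) p μ :=
  hf.comp_measurePreserving (Measure.measurePreserving_sub_left μ x)

lemma continuous_eLpNorm_sub_translate (hp : 1 ≤ p) (hp' : p ≠ ⊤) (hf : MemLp f p μ) :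
    Continuous fun y => eLpNorm (fun x => f x - f (x - y)) p μ := by
  have : Fact (1 ≤ p) := ⟨hp⟩
  let τ : C(E, C(E, E)) := ContinuousMap.curry ⟨fun q : E × E => q.2 - q.1, by fun_prop⟩
  have hτ (y : E) : MeasurePreserving (τ y) μ μ := measurePreserving_sub_right μ y
  have hcont := (continuous_const (y := hf.toLp f)).compMeasurePreservingLp τ.continuous hτ hp'
  refine (continuous_const (y := hf.toLp f).edist hcont).congr fun y => ?_
  rw [Lp.toLp_compMeasurePreserving, Lp.edist_toLp_toLp]
  rfl

variable [NormedSpace ℝ F] {k : E → ℝ}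

lemma eLpNorm_convolution_le (hp : 1 ≤ p) (hp' : p ≠ ⊤) (hk : AEStronglyMeasurable k μ)
    (hf : AEStronglyMeasurable f μ) :
    eLpNorm (k ⋆[lsmul ℝ ℝ, μ] f) p μ ≤ (∫⁻ y, ‖k y‖ₑ ∂μ) * eLpNorm f p μ := by
  have hp0 : p ≠ 0 := (one_pos.trans_le hp).ne'
  have hpos : 0 < p.toReal := ENNReal.toReal_pos hp0 hp'
  have hp1 : 1 ≤ p.toReal := ENNReal.toReal_one ▸ ENNReal.toReal_mono hp' hp
  rw [← ENNReal.rpow_le_rpow_iff hpos, ENNReal.mul_rpow_of_nonneg _ _ hpos.le,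
    eLpNorm_rpow_toReal hp0 hp', eLpNorm_rpow_toReal hp0 hp']
  calc _ ≤ ∫⁻ x, (∫⁻ y, ‖k y‖ₑ * ‖f (x - y)‖ₑ ∂μ) ^ p.toReal ∂μ := by
        gcongr with x
        refine (enorm_integral_le_lintegral_enorm _).trans_eq ?_
        simp only [ContinuousLinearMap.lsmul_apply, enorm_smul]
    _ ≤ (∫⁻ y, ‖k y‖ₑ ∂μ) ^ (p.toReal - 1) *
        ∫⁻ y, ‖k y‖ₑ * ∫⁻ x, ‖f (x - y)‖ₑ ^ p.toReal ∂μ ∂μ :=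
        lintegral_lintegral_mul_rpow_le hp1 hk.enorm (aestronglyMeasurable_comp_sub hf).enorm
    _ = _ := by
        simp_rw [lintegral_sub_right_eq_self (fun x => ‖f x‖ₑ ^ p.toReal)]
        rw [lintegral_mul_const'' _ hk.enorm, ← mul_assoc]
        conv_lhs => enter [1, 2]; rw [← ENNReal.rpow_one (∫⁻ y, ‖k y‖ₑ ∂μ)]
        rw [← ENNReal.rpow_add_of_nonneg _ _ (sub_nonneg.2 hp1) zero_le_one, sub_add_cancel]

lemma eLpNorm_sub_convolution_rpow_le [CompleteSpace F] (hp : 1 ≤ p) (hp' : p ≠ ⊤)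
    (hk : Integrable k μ) (hk1 : ∫ y, k y ∂μ = 1) (hf : AEStronglyMeasurable f μ)
    (hkf : ConvolutionExists k f (lsmul ℝ ℝ) μ) :
    eLpNorm (fun x => f x - (k ⋆[lsmul ℝ ℝ, μ] f) x) p μ ^ p.toReal ≤
      (∫⁻ y, ‖k y‖ₑ ∂μ) ^ (p.toReal - 1) *
        ∫⁻ y, ‖k y‖ₑ * eLpNorm (fun x => f x - f (x - y)) p μ ^ p.toReal ∂μ := by
  have hp0 : p ≠ 0 := (one_pos.trans_le hp).ne'
  have hp1 : 1 ≤ p.toReal := ENNReal.toReal_one ▸ ENNReal.toReal_mono hp' hp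
  simp_rw [eLpNorm_rpow_toReal hp0 hp']
  have hdiff (x : E) : f x - (k ⋆[lsmul ℝ ℝ, μ] f) x = ∫ y, k y • (f x - f (x - y)) ∂μ := by
    have hsub := integral_sub (hk.smul_const (f x)) (hkf x)
    simp only [ContinuousLinearMap.lsmul_apply, ← smul_sub] at hsub
    rw [hsub, integral_smul_const, hk1, one_smul, convolution_lsmul]
  refine le_trans (lintegral_mono fun x => ENNReal.rpow_le_rpow ?_ ENNReal.toReal_nonneg)
    (lintegral_lintegral_mul_rpow_le hp1 hk.1.enorm
      (hf.comp_fst.sub (aestronglyMeasurable_comp_sub hf)).enorm)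
  rw [hdiff]
  refine (enorm_integral_le_lintegral_enorm _).trans_eq ?_
  simp only [enorm_smul]

end Convolution

section GaussianDecay

variable {V : Type*} [NormedAddCommGroup V] [MeasurableSpace V]

/-- A measurable kernel dominated by a Gaussian; convolution with it is defined on every `L^p`. -/
def GaussianDecay (k : V → ℝ) : Prop :=
  Measurable k ∧ ∃ C c : ℝ, 0 < c ∧ ∀ z, |k z| ≤ C * Real.exp (-c * ‖z‖ ^ 2)

/-- A jointly measurable family of kernels, dominated by one Gaussian for all parameters in `s`. -/
def UniformGaussianDecay (s : Set ℝ) (k : ℝ → V → ℝ) : Prop :=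
  Measurable (Function.uncurry k) ∧
    ∃ C c : ℝ, 0 < c ∧ ∀ t ∈ s, ∀ z, |k t z| ≤ C * Real.exp (-c * ‖z‖ ^ 2)

/-- The integral over `t ∈ s` of a family of kernels. -/
noncomputable def timeIntegral (s : Set ℝ) (k : ℝ → V → ℝ) (z : V) : ℝ :=
  ∫ t in s, k t z

lemma GaussianDecay.norm {k : V → ℝ} (hk : GaussianDecay k) : GaussianDecay fun z => ‖k z‖ :=
  let ⟨hmeas, C, c, hc, hbound⟩ := hk
  ⟨hmeas.norm, C, c, hc, fun z => (abs_norm _).trans_le (hbound z)⟩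

variable {s : Set ℝ} {k : ℝ → V → ℝ}

lemma UniformGaussianDecay.gaussianDecay (hk : UniformGaussianDecay s k) {t : ℝ} (ht : t ∈ s) :
    GaussianDecay (k t) :=
  let ⟨hmeas, C, c, hc, hbound⟩ := hk
  ⟨hmeas.of_uncurry_left, C, c, hc, hbound t ht⟩

lemma UniformGaussianDecay.gaussianDecay_timeIntegral (hk : UniformGaussianDecay s k)
    (hs : volume s ≠ ⊤) : GaussianDecay (timeIntegral s k) := by
  obtain ⟨hmeas, C, c, hc, hbound⟩ := hk
  refine ⟨hmeas.stronglyMeasurable.integral_prod_left.measurable, C * volume.real s, c, hc,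
    fun z => ?_⟩
  rw [mul_right_comm]
  exact norm_setIntegral_le_of_norm_le_const (f := fun t => k t z) hs.lt_top
    fun t ht => hbound t ht z

variable {F : Type*} [InnerProductSpace ℝ V] [FiniteDimensional ℝ V] [BorelSpace V]
  [NormedAddCommGroup F] [NormedSpace ℝ F] {p : ℝ≥0∞}

lemma integrable_exp_neg_mul_sq_norm {c : ℝ} (hc : 0 < c) :
    Integrable fun z : V => Real.exp (-c * ‖z‖ ^ 2) := by
  refine ((GaussianFourier.integrable_cexp_neg_mul_sq_norm_add (V := V) (b := (c : ℂ))
    (by simpa using hc) 0 0).re).congr (ae_of_all _ fun z => ?_)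
  have hreal : -(c : ℂ) * (‖z‖ : ℂ) ^ 2 + 0 * (inner ℝ (0 : V) z : ℂ) =
      ((-c * ‖z‖ ^ 2 : ℝ) : ℂ) := by push_cast; ring
  simp only [hreal]
  exact Complex.exp_ofReal_re _

lemma memLp_exp_neg_mul_sq_norm {c : ℝ} (hc : 0 < c) (hp : p ≠ 0) :
    MemLp (fun z : V => Real.exp (-c * ‖z‖ ^ 2)) p := by
  have hmeas : AEStronglyMeasurable (fun z : V => Real.exp (-c * ‖z‖ ^ 2)) volume :=
    (by fun_prop : Continuous fun z : V => Real.exp (-c * ‖z‖ ^ 2)).aestronglyMeasurable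
  rcases eq_or_ne p ⊤ with rfl | hp'
  · refine memLp_top_of_bound hmeas 1 (ae_of_all _ fun z => ?_)
    rw [Real.norm_eq_abs, Real.abs_exp, Real.exp_le_one_iff]
    nlinarith [sq_nonneg ‖z‖]
  · rw [← integrable_norm_rpow_iff hmeas hp hp']
    refine (integrable_exp_neg_mul_sq_norm
      (mul_pos (ENNReal.toReal_pos hp hp') hc)).congr (ae_of_all _ fun z => ?_)
    simp only [Real.norm_eq_abs, Real.abs_exp]
    rw [← Real.exp_mul]
    ring_nf

lemma GaussianDecay.memLp {k : V → ℝ} (hk : GaussianDecay k) (hp : p ≠ 0) : MemLp k p := by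
  obtain ⟨hmeas, C, c, hc, hbound⟩ := hk
  exact (memLp_exp_neg_mul_sq_norm hc hp).of_le_mul hmeas.aestronglyMeasurable
    (ae_of_all _ fun z => by simpa only [Real.norm_eq_abs, Real.abs_exp] using hbound z)

lemma GaussianDecay.integrable {k : V → ℝ} (hk : GaussianDecay k) : Integrable k :=
  memLp_one_iff_integrable.1 (hk.memLp one_ne_zero)

lemma GaussianDecay.integrable_smul {k : V → ℝ} (hk : GaussianDecay k) (hp : 1 ≤ p) {f : V → F}
    (hf : MemLp f p) : Integrable fun y => k y • f y := by
  have := ENNReal.HolderConjugate.conjExponent hp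
  have hq : p.conjExponent ≠ 0 := (ENNReal.HolderConjugate.symm (p := p)).ne_zero
  exact memLp_one_iff_integrable.1 (hf.smul (hk.memLp hq))

lemma GaussianDecay.convolutionExists {k : V → ℝ} (hk : GaussianDecay k) (hp : 1 ≤ p)
    {f : V → F} (hf : MemLp f p) : ConvolutionExists k f (lsmul ℝ ℝ) :=
  fun x => hk.integrable_smul hp (memLp_comp_sub_left hf x)

lemma GaussianDecay.memLp_convolution {k : V → ℝ} (hk : GaussianDecay k) (hp : 1 ≤ p)
    (hp' : p ≠ ⊤) {f : V → F} (hf : MemLp f p) : MemLp (k ⋆ f) p := by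
  refine ⟨?_, (eLpNorm_convolution_le hp hp' hk.1.aestronglyMeasurable hf.1).trans_lt
    (ENNReal.mul_lt_top hk.integrable.2 hf.2)⟩
  exact (AEStronglyMeasurable.smul hk.1.aestronglyMeasurable.comp_snd
    (aestronglyMeasurable_comp_sub hf.1)).integral_prod_right'

lemma GaussianDecay.convolution_assoc [CompleteSpace F] {k l : V → ℝ} (hk : GaussianDecay k)
    (hl : GaussianDecay l) (hp : 1 ≤ p) (hp' : p ≠ ⊤) {f : V → F} (hf : MemLp f p) (x : V) :
    ((k ⋆ l) ⋆ f) x = (k ⋆ (l ⋆ f)) x := by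
  have hlnorm : MemLp ((fun y => ‖l y‖) ⋆ fun y => ‖f y‖) p :=
    hl.norm.memLp_convolution hp hp' hf.norm
  exact MeasureTheory.convolution_assoc _ _ _ _ (fun a b v => mul_smul a b v)
    hk.1.aestronglyMeasurable hl.1.aestronglyMeasurable hf.1
    (ae_of_all _ (hk.convolutionExists le_rfl (memLp_one_iff_integrable.2 hl.integrable)))
    (ae_of_all _ (hl.norm.convolutionExists hp hf.norm))
    (hk.norm.convolutionExists hp hlnorm x)

lemma UniformGaussianDecay.integrable_smul (hk : UniformGaussianDecay s k)
    (hs : MeasurableSet s) (hs' : volume s ≠ ⊤) (hp : 1 ≤ p) {f : V → F} (hf : MemLp f p) :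
    Integrable (fun q : ℝ × V => k q.1 q.2 • f q.2) ((volume.restrict s).prod volume) := by
  obtain ⟨hmeas, C, c, hc, hbound⟩ := hk
  have : IsFiniteMeasure (volume.restrict s) := ⟨by simpa using hs'.lt_top⟩
  have hgauss : GaussianDecay fun z : V => C * Real.exp (-c * ‖z‖ ^ 2) :=
    ⟨by fun_prop, |C|, c, hc, fun z => by rw [abs_mul, Real.abs_exp]⟩
  refine ((hgauss.integrable_smul hp hf).norm.comp_snd (volume.restrict s)).mono'
    (AEStronglyMeasurable.smul hmeas.aestronglyMeasurable hf.1.comp_snd) ?_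
  have hmem : ∀ᵐ q ∂(volume.restrict s).prod (volume : Measure V), q.1 ∈ s :=
    Measure.quasiMeasurePreserving_fst.ae (ae_restrict_mem hs)
  filter_upwards [hmem] with q hq
  simp only [norm_smul]
  gcongr
  exact (hbound q.1 hq q.2).trans (le_abs_self _)

lemma UniformGaussianDecay.timeIntegral_convolution [CompleteSpace F]
    (hk : UniformGaussianDecay s k) (hs : MeasurableSet s) (hs' : volume s ≠ ⊤) (hp : 1 ≤ p)
    {f : V → F} (hf : MemLp f p) (x : V) :
    (timeIntegral s k ⋆ f) x = ∫ t in s, (k t ⋆ f) x := by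
  simp only [convolution_lsmul, timeIntegral, ← integral_smul_const]
  exact (integral_integral_swap (f := fun t y => k t y • f (x - y))
    (hk.integrable_smul hs hs' hp (memLp_comp_sub_left hf x))).symm

end GaussianDecay

section HeatKernel

/-- The heat kernel on `ℝ³`. -/
noncomputable def heatKernel (t : ℝ) (z : R3) : ℝ :=
  (4 * Real.pi * t) ^ (-(3 / 2) : ℝ) * Real.exp (-‖z‖ ^ 2 / (4 * t))

/-- The partial derivative `∂ⱼ` of the heat kernel. -/
noncomputable def heatKernelD (j : Fin 3) (t : ℝ) (z : R3) : ℝ :=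
  -(z j / (2 * t)) * heatKernel t z

/-- The second partial derivative `∂ᵢ∂ⱼ` of the heat kernel. -/
noncomputable def heatKernelDD (i j : Fin 3) (t : ℝ) (z : R3) : ℝ :=
  (z i * z j / (4 * t ^ 2) - (if i = j then 1 else 0) / (2 * t)) * heatKernel t z

lemma heatKernel_pos {t : ℝ} (ht : 0 < t) (z : R3) : 0 < heatKernel t z := by
  unfold heatKernel; positivity

lemma heatKernel_eq (t : ℝ) (z : R3) : heatKernel t z =
    (4 * Real.pi * t) ^ (-(3 / 2) : ℝ) * Real.exp (-(1 / (4 * t)) * ‖z‖ ^ 2) := by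
  unfold heatKernel; congr 2; ring

lemma heatKernel_le {t : ℝ} (ht : 0 < t) (z : R3) :
    heatKernel t z ≤ (4 * Real.pi * t) ^ (-(3 / 2) : ℝ) := by
  refine mul_le_of_le_one_right (by positivity) (Real.exp_le_one_iff.2 ?_)
  rw [neg_div, neg_nonpos]
  positivity

lemma integral_heatKernel {t : ℝ} (ht : 0 < t) : ∫ z, heatKernel t z = 1 := by
  have hscale : Real.pi / (1 / (4 * t)) = 4 * Real.pi * t := by field_simp
  simp_rw [heatKernel_eq]
  rw [integral_const_mul, GaussianFourier.integral_rexp_neg_mul_sq_norm (by positivity), hscale,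
    finrank_euclideanSpace_fin, ← Real.rpow_add (by positivity)]
  norm_num

lemma integrable_heatKernel {t : ℝ} (ht : 0 < t) : Integrable (heatKernel t) :=
  .of_integral_ne_zero (by rw [integral_heatKernel ht]; exact one_ne_zero)

lemma enorm_heatKernel {t : ℝ} (ht : 0 < t) (z : R3) :
    ‖heatKernel t z‖ₑ = ENNReal.ofReal (heatKernel t z) :=
  Real.enorm_eq_ofReal (heatKernel_pos ht z).le

lemma lintegral_enorm_heatKernel {t : ℝ} (ht : 0 < t) : ∫⁻ z, ‖heatKernel t z‖ₑ = 1 := by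
  simp_rw [enorm_heatKernel ht]
  rw [← ofReal_integral_eq_lintegral_ofReal (integrable_heatKernel ht)
    (ae_of_all _ fun z => (heatKernel_pos ht z).le), integral_heatKernel ht, ENNReal.ofReal_one]

lemma heatKernel_le_mul_heatKernel_two_mul {t : ℝ} (ht : 0 < t) (z : R3) :
    heatKernel t z ≤ 3 * (Real.exp (-(‖z‖ ^ 2 / (8 * t))) * heatKernel (2 * t) z) := by
  have hpow : (4 * Real.pi * t) ^ (-(3 / 2) : ℝ) ≤
      3 * (4 * Real.pi * (2 * t)) ^ (-(3 / 2) : ℝ) := by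
    have htwo : (2 : ℝ) ^ (3 / 2 : ℝ) ≤ 3 := by
      refine le_of_sq_le_sq ?_ (by norm_num)
      rw [← Real.rpow_natCast, ← Real.rpow_mul (by norm_num)]
      norm_num
    rw [mul_left_comm, Real.mul_rpow zero_le_two (by positivity), ← mul_assoc]
    refine le_mul_of_one_le_left (by positivity) ?_
    rwa [Real.rpow_neg zero_le_two, ← div_eq_mul_inv, one_le_div (by positivity)]
  have hexp : Real.exp (-‖z‖ ^ 2 / (4 * t)) =
      Real.exp (-(‖z‖ ^ 2 / (8 * t))) * Real.exp (-‖z‖ ^ 2 / (4 * (2 * t))) := by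
    rw [← Real.exp_add]; congr 1; field_simp; ring
  unfold heatKernel
  rw [hexp]
  refine (mul_le_mul_of_nonneg_right hpow (by positivity)).trans_eq ?_
  ring

/- The factor `exp (-‖z‖² / (8 * t))` of the previous bound absorbs the polynomial factors of the
derivatives of the kernel. -/
lemma abs_mul_heatKernel_le {t : ℝ} (ht : 0 < t) {z : R3} {a C : ℝ}
    (ha : |a| ≤ C * (‖z‖ ^ 2 / (8 * t) + 1)) (hC : 0 ≤ C) :
    |a * heatKernel t z| ≤ 3 * C * heatKernel (2 * t) z := by
  have := heatKernel_pos (show 0 < 2 * t by positivity) z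
  rw [abs_mul, abs_of_pos (heatKernel_pos ht z)]
  calc |a| * heatKernel t z
      ≤ C * Real.exp (‖z‖ ^ 2 / (8 * t)) *
          (3 * (Real.exp (-(‖z‖ ^ 2 / (8 * t))) * heatKernel (2 * t) z)) := by
        gcongr
        · exact (heatKernel_pos ht z).le
        · exact ha.trans (mul_le_mul_of_nonneg_left (Real.add_one_le_exp _) hC)
        · exact heatKernel_le_mul_heatKernel_two_mul ht z
    _ = 3 * C * heatKernel (2 * t) z := by
        rw [Real.exp_neg]; field_simp

lemma abs_coord_le_norm (z : R3) (i : Fin 3) : |z i| ≤ ‖z‖ := by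
  simpa only [Real.norm_eq_abs] using PiLp.norm_apply_le z i

lemma abs_heatKernelD_le (j : Fin 3) {t : ℝ} (ht : 0 < t) (z : R3) :
    |heatKernelD j t z| ≤ 3 * t ^ (-(1 / 2) : ℝ) * heatKernel (2 * t) z := by
  refine abs_mul_heatKernel_le ht (abs_le_of_sq_le_sq ?_ (by positivity)) (by positivity)
  have hcoord : z j ^ 2 ≤ ‖z‖ ^ 2 := sq_le_sq.2 (by simpa using abs_coord_le_norm z j)
  have hpow : (t ^ (-(1 / 2) : ℝ)) ^ 2 = t⁻¹ := by
    rw [← Real.rpow_natCast, ← Real.rpow_mul ht.le, ← Real.rpow_neg_one]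
    norm_num
  calc (-(z j / (2 * t))) ^ 2 = t⁻¹ * (2 * (z j ^ 2 / (8 * t))) := by field_simp; ring
    _ ≤ t⁻¹ * (‖z‖ ^ 2 / (8 * t) + 1) ^ 2 := by
        gcongr
        have : z j ^ 2 / (8 * t) ≤ ‖z‖ ^ 2 / (8 * t) := by gcongr
        nlinarith [sq_nonneg (‖z‖ ^ 2 / (8 * t))]
    _ = _ := by rw [mul_pow, hpow]

lemma abs_heatKernelDD_le (i j : Fin 3) {t : ℝ} (ht : 0 < t) (z : R3) :
    |heatKernelDD i j t z| ≤ 6 / t * heatKernel (2 * t) z := by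
  have hbound : |z i * z j / (4 * t ^ 2) - (if i = j then 1 else 0) / (2 * t)| ≤
      2 / t * (‖z‖ ^ 2 / (8 * t) + 1) := by
    calc _ ≤ ‖z‖ ^ 2 / (4 * t ^ 2) + 1 / (2 * t) := by
          refine (abs_sub _ _).trans ?_
          rw [abs_div, abs_div, abs_mul, abs_of_pos (show 0 < 4 * t ^ 2 by positivity),
            abs_of_pos (show 0 < 2 * t by positivity), sq ‖z‖]
          gcongr
          · exact abs_coord_le_norm z i
          · exact abs_coord_le_norm z j
          · split_ifs <;> simp
      _ ≤ _ := by
          field_simp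
          linarith
  refine (abs_mul_heatKernel_le ht hbound (by positivity)).trans_eq ?_
  ring

lemma measurable_heatKernel : Measurable (Function.uncurry heatKernel) := by
  unfold heatKernel Function.uncurry
  fun_prop

lemma measurable_heatKernelD (j : Fin 3) : Measurable (Function.uncurry (heatKernelD j)) :=
  ((by fun_prop : Measurable fun q : ℝ × R3 => -(q.2 j / (2 * q.1)))).mul measurable_heatKernel

lemma measurable_heatKernelDD (i j : Fin 3) :
    Measurable (Function.uncurry (heatKernelDD i j)) :=
  ((by fun_prop : Measurable fun q : ℝ × R3 =>
    q.2 i * q.2 j / (4 * q.1 ^ 2) - (if i = j then 1 else 0) / (2 * q.1))).mul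
      measurable_heatKernel

lemma uniformGaussianDecay_of_abs_le_heatKernel {k : ℝ → R3 → ℝ}
    (hk : Measurable (Function.uncurry k)) {ε T C : ℝ} (hε : 0 < ε)
    (hbound : ∀ t ∈ Icc ε T, ∀ z, |k t z| ≤ C * heatKernel (2 * t) z) :
    UniformGaussianDecay (Icc ε T) k := by
  rcases lt_or_ge T ε with hT | hT
  · exact ⟨hk, 0, 1, one_pos, fun t ht => absurd (ht.1.trans ht.2) hT.not_ge⟩
  have hT0 : 0 < T := hε.trans_le hT
  refine ⟨hk, |C| * (4 * Real.pi * (2 * ε)) ^ (-(3 / 2) : ℝ), 1 / (4 * (2 * T)), by positivity,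
    fun t ht z => ?_⟩
  have ht0 : 0 < t := hε.trans_le ht.1
  calc |k t z| ≤ |C| * heatKernel (2 * t) z :=
        (hbound t ht z).trans (mul_le_mul_of_nonneg_right (le_abs_self C)
          (heatKernel_pos (by positivity) z).le)
    _ ≤ |C| * ((4 * Real.pi * (2 * ε)) ^ (-(3 / 2) : ℝ) *
          Real.exp (-(1 / (4 * (2 * T))) * ‖z‖ ^ 2)) := by
        rw [heatKernel_eq]
        refine mul_le_mul_of_nonneg_left (mul_le_mul ?_ ?_ (Real.exp_pos _).le (by positivity))
          (abs_nonneg C)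
        · exact Real.rpow_le_rpow_of_nonpos (by positivity) (by gcongr; exact ht.1) (by norm_num)
        · refine Real.exp_le_exp.2 ?_
          gcongr
          exact ht.2
    _ = _ := (mul_assoc _ _ _).symm

lemma uniformGaussianDecay_heatKernelD (j : Fin 3) {ε T : ℝ} (hε : 0 < ε) :
    UniformGaussianDecay (Icc ε T) (heatKernelD j) := by
  refine uniformGaussianDecay_of_abs_le_heatKernel (measurable_heatKernelD j)
    (C := 3 * ε ^ (-(1 / 2) : ℝ)) hε fun t ht z => ?_
  have ht0 : 0 < t := hε.trans_le ht.1
  refine (abs_heatKernelD_le j ht0 z).trans ?_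
  have := heatKernel_pos (show 0 < 2 * t by positivity) z
  gcongr ?_ * _
  exact mul_le_mul_of_nonneg_left (Real.rpow_le_rpow_of_nonpos hε ht.1 (by norm_num)) (by norm_num)

lemma uniformGaussianDecay_heatKernelDD (i j : Fin 3) {ε T : ℝ} (hε : 0 < ε) :
    UniformGaussianDecay (Icc ε T) (heatKernelDD i j) := by
  refine uniformGaussianDecay_of_abs_le_heatKernel (measurable_heatKernelDD i j)
    (C := 6 / ε) hε fun t ht z => ?_
  have ht0 : 0 < t := hε.trans_le ht.1
  refine (abs_heatKernelDD_le i j ht0 z).trans ?_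
  have := heatKernel_pos (show 0 < 2 * t by positivity) z
  gcongr
  exact ht.1

lemma gaussianDecay_heatKernel {t : ℝ} (ht : 0 < t) : GaussianDecay (heatKernel t) :=
  ⟨measurable_heatKernel.of_uncurry_left, _, _, by positivity, fun z =>
    (abs_of_pos (heatKernel_pos ht z)).trans_le (heatKernel_eq t z).le⟩

lemma gaussianDecay_heatKernelD (j : Fin 3) {t : ℝ} (ht : 0 < t) :
    GaussianDecay (heatKernelD j t) :=
  (uniformGaussianDecay_heatKernelD j ht).gaussianDecay ⟨le_rfl, le_rfl⟩

lemma contDiff_heatKernel (t : ℝ) : ContDiff ℝ ∞ (heatKernel t) :=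
  contDiff_const.mul (((contDiff_norm_sq ℝ).neg.div_const _).exp)

lemma contDiff_coord (j : Fin 3) : ContDiff ℝ ∞ fun z : R3 => z j :=
  (EuclideanSpace.proj j : R3 →L[ℝ] ℝ).contDiff

lemma contDiff_heatKernelD (j : Fin 3) (t : ℝ) : ContDiff ℝ ∞ (heatKernelD j t) :=
  ((contDiff_coord j).div_const _).neg.mul (contDiff_heatKernel t)

lemma partialDeriv_heatKernel (i : Fin 3) {t : ℝ} (ht : 0 < t) (z : R3) :
    partialDeriv i (heatKernel t) z = heatKernelD i t z := by
  have hsq : HasFDerivAt (fun z : R3 => ‖z‖ ^ 2) (2 • innerSL ℝ z) z :=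
    (hasStrictFDerivAt_norm_sq z).hasFDerivAt
  have hK : HasFDerivAt (heatKernel t) _ z :=
    ((hsq.fun_neg.mul_const ((4 * t)⁻¹)).exp).const_mul ((4 * Real.pi * t) ^ (-(3 / 2) : ℝ))
  rw [partialDeriv, hK.fderiv]
  simp only [mul_inv_rev, neg_mul, smul_neg, neg_apply, smul_apply, coe_innerSL_apply,
    EuclideanSpace.inner_single_right, Real.ringHom_apply, one_mul, nsmul_eq_mul, Nat.cast_ofNat,
    smul_eq_mul, heatKernelD, heatKernel, neg_inj]
  field_simp
  norm_num

lemma partialDeriv_heatKernelD (i j : Fin 3) {t : ℝ} (ht : 0 < t) (z : R3) :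
    partialDeriv i (heatKernelD j t) z = heatKernelDD i j t z := by
  have hcoord : HasFDerivAt (fun z : R3 => z j) (EuclideanSpace.proj j : R3 →L[ℝ] ℝ) z :=
    (EuclideanSpace.proj j : R3 →L[ℝ] ℝ).hasFDerivAt
  have hK : HasFDerivAt (heatKernel t) (fderiv ℝ (heatKernel t) z) z :=
    ((contDiff_heatKernel t).differentiable (by simp) z).hasFDerivAt
  have hD : HasFDerivAt (heatKernelD j t) _ z :=
    ((hcoord.mul_const ((2 * t)⁻¹)).fun_neg).mul hK
  have hpartial := partialDeriv_heatKernel i ht z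
  unfold partialDeriv at hpartial ⊢
  rw [hD.fderiv]
  simp only [add_apply, smul_apply, hpartial]
  rcases eq_or_ne i j with rfl | hij
  · simp only [heatKernelD, heatKernelDD, smul_eq_mul, neg_apply, smul_apply, PiLp.proj_apply,
      PiLp.single_eq_same, ↓reduceIte]
    field_simp
    ring
  · simp only [heatKernelD, heatKernelDD, smul_eq_mul, neg_apply, smul_apply, PiLp.proj_apply,
      ne_eq, hij.symm, not_false_eq_true, PiLp.single_eq_of_ne, hij, ↓reduceIte]
    field_simp
    ring

lemma hasDerivAt_heatKernel {t : ℝ} (ht : 0 < t) (z : R3) :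
    HasDerivAt (fun s => heatKernel s z) (∑ j, heatKernelDD j j t z) t := by
  have hpow : HasDerivAt (fun s : ℝ => (4 * Real.pi * s) ^ (-(3 / 2) : ℝ)) _ t :=
    ((hasDerivAt_id t).const_mul (4 * Real.pi)).rpow_const (Or.inl (by rw [id_eq]; positivity))
  have hinv : HasDerivAt (fun s : ℝ => -‖z‖ ^ 2 / (4 * s)) _ t :=
    (((hasDerivAt_id t).const_mul 4).fun_inv (by rw [id_eq]; positivity)).const_mul (-‖z‖ ^ 2)
  refine (hpow.mul hinv.exp).congr_deriv ?_
  have hnorm : ‖z‖ ^ 2 = z 0 ^ 2 + z 1 ^ 2 + z 2 ^ 2 := by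
    simp [EuclideanSpace.norm_sq_eq, Fin.sum_univ_three]
  simp only [Fin.sum_univ_three, heatKernelDD, heatKernel, if_true, id,
    Real.rpow_sub_one (show 4 * Real.pi * t ≠ 0 by positivity)]
  rw [hnorm]
  field_simp
  ring

lemma heatKernel_add_mul_heatKernel_sub {s : ℝ} (hs : 0 < s) (z v : R3) :
    heatKernel s ((1 / 2 : ℝ) • z + v) * heatKernel s ((1 / 2 : ℝ) • z - v) =
      heatKernel (2 * s) z * heatKernel (s / 2) v := by
  have hparallelogram : ‖(1 / 2 : ℝ) • z + v‖ ^ 2 + ‖(1 / 2 : ℝ) • z - v‖ ^ 2 =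
      ‖z‖ ^ 2 / 2 + 2 * ‖v‖ ^ 2 := by
    have hnorm : ‖(1 / 2 : ℝ) • z‖ = ‖z‖ / 2 := by rw [norm_smul]; norm_num; ring
    have := parallelogram_law_with_norm ℝ ((1 / 2 : ℝ) • z) v
    rw [hnorm] at this
    linarith
  unfold heatKernel
  rw [mul_mul_mul_comm, mul_mul_mul_comm ((4 * Real.pi * (2 * s)) ^ (-(3 / 2) : ℝ)),
    ← Real.mul_rpow (by positivity) (by positivity),
    ← Real.mul_rpow (by positivity) (by positivity), ← Real.exp_add, ← Real.exp_add]
  congr 2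
  · ring
  · rw [← add_div, ← neg_add, hparallelogram]
    field_simp
    ring

lemma integral_heatKernelD (j : Fin 3) (t : ℝ) : ∫ z, heatKernelD j t z = 0 := by
  have hodd (z : R3) : heatKernelD j t (-z) = -heatKernelD j t z := by
    simp only [heatKernelD, heatKernel, norm_neg, PiLp.neg_apply]
    ring
  have hneg := integral_neg_eq_self (heatKernelD j t) volume
  simp_rw [hodd, integral_neg] at hneg
  linarith

lemma heatKernelD_convolution_heatKernel (j : Fin 3) {s : ℝ} (hs : 0 < s) :
    heatKernelD j s ⋆ heatKernel s = heatKernelD j (2 * s) := by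
  ext z
  have hmid (v : R3) : heatKernelD j s ((1 / 2 : ℝ) • z + v) •
      heatKernel s (z - ((1 / 2 : ℝ) • z + v)) =
      heatKernelD j (2 * s) z * heatKernel (s / 2) v +
        heatKernel (2 * s) z / 2 * heatKernelD j (s / 2) v := by
    have hsub : z - ((1 / 2 : ℝ) • z + v) = (1 / 2 : ℝ) • z - v := by module
    rw [hsub, smul_eq_mul, heatKernelD, mul_assoc, heatKernel_add_mul_heatKernel_sub hs]
    simp only [heatKernelD, PiLp.add_apply, PiLp.smul_apply, smul_eq_mul]
    field_simp
    ring
  rw [convolution_lsmul, ← integral_add_left_eq_self _ ((1 / 2 : ℝ) • z)]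
  simp_rw [hmid]
  rw [integral_add ((integrable_heatKernel (by positivity)).const_mul _)
    ((gaussianDecay_heatKernelD j (by positivity)).integrable.const_mul _), integral_const_mul,
    integral_const_mul, integral_heatKernel (by positivity), integral_heatKernelD]
  ring

lemma heatSemigroup_eq_convolution (t : ℝ) (B : R3 → R3) :
    heatSemigroup t B = heatKernel t ⋆ B := by
  ext1 x
  rw [convolution_lsmul_swap]
  rfl

variable {F : Type*} [NormedAddCommGroup F] [NormedSpace ℝ F] {p : ℝ≥0∞} {f : R3 → F}

lemma eLpNorm_heatKernel_convolution_le (hp : 1 ≤ p) (hp' : p ≠ ⊤) {t : ℝ} (ht : 0 < t)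
    (hf : AEStronglyMeasurable f) : eLpNorm (heatKernel t ⋆ f) p ≤ eLpNorm f p :=
  (eLpNorm_convolution_le hp hp' (integrable_heatKernel ht).1 hf).trans_eq
    (by rw [lintegral_enorm_heatKernel ht, one_mul])

lemma eLpNorm_heatKernel_convolution_rpow_le (hp : 1 ≤ p) (hp' : p ≠ ⊤) {t : ℝ} (ht : 0 < t)
    (hf : Integrable f) : eLpNorm (heatKernel t ⋆ f) p ^ p.toReal ≤
      (ENNReal.ofReal ((4 * Real.pi * t) ^ (-(3 / 2) : ℝ)) * ∫⁻ y, ‖f y‖ₑ) ^ (p.toReal - 1) *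
        ∫⁻ y, ‖f y‖ₑ := by
  have hp1 : 1 ≤ p.toReal := ENNReal.toReal_one ▸ ENNReal.toReal_mono hp' hp
  have hsup (x : R3) : ‖(heatKernel t ⋆ f) x‖ₑ ≤
      ENNReal.ofReal ((4 * Real.pi * t) ^ (-(3 / 2) : ℝ)) * ∫⁻ y, ‖f y‖ₑ := by
    rw [convolution_lsmul_swap, ← lintegral_const_mul' _ _ ENNReal.ofReal_ne_top]
    refine (enorm_integral_le_lintegral_enorm _).trans (lintegral_mono fun y => ?_)
    rw [enorm_smul, enorm_heatKernel ht]
    gcongr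
    exact heatKernel_le ht _
  have hL1 : eLpNorm (heatKernel t ⋆ f) 1 ≤ eLpNorm f 1 :=
    eLpNorm_heatKernel_convolution_le le_rfl ENNReal.one_ne_top ht hf.1
  rw [eLpNorm_one_eq_lintegral_enorm, eLpNorm_one_eq_lintegral_enorm] at hL1
  rw [eLpNorm_rpow_toReal (one_pos.trans_le hp).ne' hp']
  refine le_trans (lintegral_mono fun x => ?_) ((lintegral_const_mul' _ _ ?_).trans_le
    (mul_le_mul_right hL1 _))
  · conv_lhs => rw [← sub_add_cancel p.toReal 1]
    rw [ENNReal.rpow_add_of_nonneg _ _ (sub_nonneg.2 hp1) zero_le_one, ENNReal.rpow_one]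
    gcongr
    exact hsup x
  · exact ENNReal.rpow_ne_top_of_nonneg (sub_nonneg.2 hp1)
      (ENNReal.mul_ne_top ENNReal.ofReal_ne_top hf.2.ne)

lemma tendsto_eLpNorm_heatKernel_convolution_of_integrable (hp : 1 < p) (hp' : p ≠ ⊤)
    (hf : Integrable f) : Tendsto (fun t => eLpNorm (heatKernel t ⋆ f) p) atTop (𝓝 0) := by
  have hp1 : 1 < p.toReal := ENNReal.toReal_one ▸ ENNReal.toReal_strict_mono hp' hp
  have hpos : 0 < p.toReal := one_pos.trans hp1
  have hdecay : Tendsto (fun t : ℝ => (4 * Real.pi * t) ^ (-(3 / 2) : ℝ)) atTop (𝓝 0) :=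
    (tendsto_rpow_neg_atTop (by norm_num)).comp (tendsto_id.const_mul_atTop (by positivity))
  have hbound := ENNReal.Tendsto.mul_const (ENNReal.Tendsto.mul_const
    (ENNReal.tendsto_ofReal hdecay) (Or.inr hf.2.ne) |>.ennrpow_const (p.toReal - 1))
    (Or.inr hf.2.ne)
  rw [ENNReal.ofReal_zero, zero_mul, ENNReal.zero_rpow_of_pos (sub_pos.2 hp1), zero_mul] at hbound
  have hroot := hbound.ennrpow_const p.toReal⁻¹
  rw [ENNReal.zero_rpow_of_pos (inv_pos.2 hpos)] at hroot
  exact tendsto_of_tendsto_of_tendsto_of_le_of_le' tendsto_const_nhds hroot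
    (.of_forall fun _ => zero_le) ((eventually_gt_atTop 0).mono fun t ht =>
      (ENNReal.le_rpow_inv_iff hpos).2 (eLpNorm_heatKernel_convolution_rpow_le hp.le hp' ht hf))

lemma tendsto_eLpNorm_heatKernel_convolution_atTop (hp : 1 < p) (hp' : p ≠ ⊤) (hf : MemLp f p) :
    Tendsto (fun t => eLpNorm (heatKernel t ⋆ f) p) atTop (𝓝 0) := by
  rw [ENNReal.tendsto_nhds_zero]
  intro η hη
  have hη2 : 0 < η / 2 := ENNReal.half_pos hη.ne'
  obtain ⟨h, hsupp, hfh, hcont, hmem⟩ :=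
    hf.exists_hasCompactSupport_eLpNorm_sub_le hp' hη2.ne'
  have hh := tendsto_eLpNorm_heatKernel_convolution_of_integrable hp hp'
    (hcont.integrable_of_hasCompactSupport hsupp)
  filter_upwards [ENNReal.tendsto_nhds_zero.1 hh _ hη2, eventually_gt_atTop 0] with t hht ht
  have hk := gaussianDecay_heatKernel ht
  have hsplit : heatKernel t ⋆ f = (heatKernel t ⋆ (f - h)) + (heatKernel t ⋆ h) := by
    rw [← ConvolutionExists.distrib_add (hk.convolutionExists hp.le (hf.sub hmem))
      (hk.convolutionExists hp.le hmem), sub_add_cancel]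
  rw [hsplit, ← ENNReal.add_halves η]
  exact (eLpNorm_add_le (hk.memLp_convolution hp.le hp' (hf.sub hmem)).1
    (hk.memLp_convolution hp.le hp' hmem).1 hp.le).trans (add_le_add
      ((eLpNorm_heatKernel_convolution_le hp.le hp' ht (hf.sub hmem).1).trans hfh) hht)

variable [CompleteSpace F]

lemma heatKernelD_two_mul_convolution (j : Fin 3) {s : ℝ} (hs : 0 < s) (hp : 1 ≤ p)
    (hp' : p ≠ ⊤) (hf : MemLp f p) :
    heatKernelD j (2 * s) ⋆ f = heatKernelD j s ⋆ (heatKernel s ⋆ f) := by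
  ext1 x
  rw [← heatKernelD_convolution_heatKernel j hs]
  exact (gaussianDecay_heatKernelD j hs).convolution_assoc (gaussianDecay_heatKernel hs) hp hp' hf x

lemma heatKernel_sqrt_smul {t : ℝ} (ht : 0 < t) (z : R3) :
    t ^ (3 / 2 : ℝ) * heatKernel t (√t • z) = heatKernel 1 z := by
  have hpow : t ^ (3 / 2 : ℝ) * (4 * Real.pi * t) ^ (-(3 / 2) : ℝ) =
      (4 * Real.pi * 1) ^ (-(3 / 2) : ℝ) := by
    rw [Real.mul_rpow (by positivity) ht.le, mul_left_comm, ← Real.rpow_add ht]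
    rw [add_neg_cancel, Real.rpow_zero, mul_one, mul_one]
  unfold heatKernel
  rw [← mul_assoc, hpow, norm_smul, mul_pow, Real.norm_eq_abs, sq_abs, Real.sq_sqrt ht.le]
  congr 2
  field_simp

lemma lintegral_heatKernel_mul_eq {t : ℝ} (ht : 0 < t) {g : R3 → ℝ≥0∞} (hg : Measurable g) :
    ∫⁻ y, ‖heatKernel t y‖ₑ * g y = ∫⁻ z, ‖heatKernel 1 z‖ₑ * g (√t • z) := by
  have hmeas : Measurable fun y => ‖heatKernel t y‖ₑ * g y :=
    (gaussianDecay_heatKernel ht).1.enorm.mul hg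
  have hscale := lintegral_map (μ := (volume : Measure R3)) hmeas (measurable_const_smul (√t))
  have hjacobian : ENNReal.ofReal (t ^ (3 / 2 : ℝ)) * ENNReal.ofReal |(√t ^ 3)⁻¹| = 1 := by
    rw [← ENNReal.ofReal_mul (by positivity), abs_of_pos (by positivity), Real.sqrt_eq_rpow,
      ← Real.rpow_natCast, ← Real.rpow_mul ht.le, ← Real.rpow_neg ht.le, ← Real.rpow_add ht]
    norm_num
  rw [Measure.map_addHaar_smul volume (Real.sqrt_pos.2 ht).ne', lintegral_smul_measure,
    finrank_euclideanSpace_fin, smul_eq_mul] at hscale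
  rw [← one_mul (∫⁻ y, _), ← hjacobian, mul_assoc, hscale,
    ← lintegral_const_mul' _ _ ENNReal.ofReal_ne_top]
  simp_rw [← mul_assoc, ← Real.enorm_of_nonneg (Real.rpow_nonneg ht.le (3 / 2)), ← enorm_mul,
    heatKernel_sqrt_smul ht]

lemma tendsto_lintegral_heatKernel_mul {g : R3 → ℝ≥0∞} (hg : Continuous g) {C : ℝ≥0∞}
    (hC : C ≠ ⊤) (hgC : ∀ y, g y ≤ C) :
    Tendsto (fun t => ∫⁻ y, ‖heatKernel t y‖ₑ * g y) (𝓝[>] 0) (𝓝 (g 0)) := by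
  have hlim : Tendsto (fun t => ∫⁻ z, ‖heatKernel 1 z‖ₑ * g (√t • z)) (𝓝[>] 0)
      (𝓝 (∫⁻ z, ‖heatKernel 1 z‖ₑ * g 0)) := by
    have hK := (gaussianDecay_heatKernel one_pos).1.enorm
    refine tendsto_lintegral_filter_of_dominated_convergence (fun z => ‖heatKernel 1 z‖ₑ * C)
      (.of_forall fun t => hK.mul (by fun_prop)) (.of_forall fun t => ae_of_all _ fun z => ?_) ?_
      (ae_of_all _ fun z => ?_)
    · gcongr
      exact hgC _
    · rwa [lintegral_mul_const _ hK, lintegral_enorm_heatKernel one_pos, one_mul]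
    · have hcont : Continuous fun t : ℝ => g (√t • z) := by fun_prop
      have hzero := hcont.tendsto 0
      rw [Real.sqrt_zero, zero_smul] at hzero
      exact ENNReal.Tendsto.const_mul (hzero.mono_left nhdsWithin_le_nhds) (Or.inr enorm_ne_top)
  rw [lintegral_mul_const _ (gaussianDecay_heatKernel one_pos).1.enorm,
    lintegral_enorm_heatKernel one_pos, one_mul] at hlim
  exact hlim.congr' (eventually_mem_nhdsWithin.mono fun t ht =>
    (lintegral_heatKernel_mul_eq ht hg.measurable).symm)

lemma tendsto_eLpNorm_sub_heatKernel_convolution (hp : 1 ≤ p) (hp' : p ≠ ⊤) (hf : MemLp f p) :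
    Tendsto (fun t => eLpNorm (fun x => f x - (heatKernel t ⋆ f) x) p volume) (𝓝[>] 0) (𝓝 0) := by
  have hpos : 0 < p.toReal := ENNReal.toReal_pos (one_pos.trans_le hp).ne' hp'
  have hmodulus := tendsto_lintegral_heatKernel_mul
    (g := fun y => eLpNorm (fun x => f x - f (x - y)) p volume ^ p.toReal)
    (ENNReal.continuous_rpow_const.comp (continuous_eLpNorm_sub_translate hp hp' hf))
    (ENNReal.rpow_ne_top_of_nonneg hpos.le (ENNReal.mul_ne_top ENNReal.ofNat_ne_top hf.2.ne))
    (fun y => ENNReal.rpow_le_rpow (eLpNorm_sub_translate_le hp hf.1 y) hpos.le)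
  simp only [sub_zero, sub_self, eLpNorm_zero', ENNReal.zero_rpow_of_pos hpos] at hmodulus
  have hroot := hmodulus.ennrpow_const p.toReal⁻¹
  rw [ENNReal.zero_rpow_of_pos (inv_pos.2 hpos)] at hroot
  refine tendsto_of_tendsto_of_tendsto_of_le_of_le' tendsto_const_nhds hroot
    (.of_forall fun _ => zero_le) (eventually_mem_nhdsWithin.mono fun t ht => ?_)
  have hJensen := eLpNorm_sub_convolution_rpow_le hp hp' (integrable_heatKernel ht)
    (integral_heatKernel ht) hf.1 ((gaussianDecay_heatKernel ht).convolutionExists hp hf)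
  rw [lintegral_enorm_heatKernel ht, ENNReal.one_rpow, one_mul] at hJensen
  exact (ENNReal.le_rpow_inv_iff hpos).2 hJensen

end HeatKernel

section WeakDerivative

variable {V : Type*} [NormedAddCommGroup V] [InnerProductSpace ℝ V] [FiniteDimensional ℝ V]
  [MeasurableSpace V] [BorelSpace V] {p : ℝ≥0∞}

lemma GaussianDecay.integrable_prod_convolution_mul {k f u : V → ℝ} (hk : GaussianDecay k)
    (hp : 1 ≤ p) (hp' : p ≠ ⊤) (hf : MemLp f p) (hu : Continuous u) (hu' : HasCompactSupport u) :
    Integrable fun q : V × V => k q.2 * f (q.1 - q.2) * u q.1 := by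
  have hmeas : AEStronglyMeasurable (fun q : V × V => k q.2 * f (q.1 - q.2) * u q.1)
      (volume.prod volume) :=
    (hk.1.aestronglyMeasurable.comp_snd.mul (aestronglyMeasurable_comp_sub hf.1)).mul
      hu.aestronglyMeasurable.comp_fst
  refine (integrable_prod_iff hmeas).2
    ⟨ae_of_all _ fun x => (hk.convolutionExists hp hf x).mul_const (u x), ?_⟩
  have habs : LocallyIntegrable ((fun z => ‖k z‖) ⋆ fun z => ‖f z‖) volume :=
    (hk.norm.memLp_convolution hp hp' hf.norm).locallyIntegrable hp
  refine (habs.integrable_smul_left_of_hasCompactSupport hu.norm hu'.norm).congr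
    (ae_of_all _ fun x => ?_)
  simp only [norm_mul, integral_mul_const, smul_eq_mul, convolution_lsmul]
  ring

lemma GaussianDecay.integrable_prod_mul_comp_add {k f u : V → ℝ} (hk : GaussianDecay k)
    (hp : 1 ≤ p) (hp' : p ≠ ⊤) (hf : MemLp f p) (hu : Continuous u) (hu' : HasCompactSupport u) :
    Integrable fun q : V × V => k q.1 * (f q.2 * u (q.2 + q.1)) := by
  have hshear : MeasurePreserving (fun q : V × V => (q.1 + q.2, q.1)) :=
    Measure.measurePreserving_swap.comp (measurePreserving_prod_add volume volume)
  refine (hshear.integrable_comp_of_integrable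
    (hk.integrable_prod_convolution_mul hp hp' hf hu hu')).congr (ae_of_all _ fun q => ?_)
  simp only [Function.comp_apply, add_sub_cancel_left, mul_assoc, add_comm]

lemma GaussianDecay.integral_convolution_mul {k f u : V → ℝ} (hk : GaussianDecay k)
    (hp : 1 ≤ p) (hp' : p ≠ ⊤) (hf : MemLp f p) (hu : Continuous u) (hu' : HasCompactSupport u) :
    ∫ x, (k ⋆ f) x * u x = ∫ z, k z * ∫ y, f y * u (y + z) := by
  have hswap := integral_integral_swap (f := fun x z => k z * f (x - z) * u x)
    (hk.integrable_prod_convolution_mul hp hp' hf hu hu')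
  simp only [convolution_lsmul, smul_eq_mul, ← integral_mul_const, hswap]
  refine integral_congr_ae (ae_of_all _ fun z => ?_)
  simp only [mul_assoc, integral_const_mul]
  rw [← integral_add_right_eq_self (fun x => f (x - z) * u x) z]
  simp only [add_sub_cancel_right]

lemma GaussianDecay.integral_convolution_mul_swap {k f u : V → ℝ} (hk : GaussianDecay k)
    (hp : 1 ≤ p) (hp' : p ≠ ⊤) (hf : MemLp f p) (hu : Continuous u) (hu' : HasCompactSupport u) :
    ∫ x, (k ⋆ f) x * u x = ∫ y, f y * ∫ z, k z * u (z + y) := by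
  rw [hk.integral_convolution_mul hp hp' hf hu hu']
  simp only [← integral_const_mul]
  rw [integral_integral_swap (f := fun z y => k z * (f y * u (y + z)))
    (hk.integrable_prod_mul_comp_add hp hp' hf hu hu')]
  simp only [mul_left_comm, add_comm]

lemma UniformGaussianDecay.integral_timeIntegral_mul {s : Set ℝ} {k : ℝ → V → ℝ}
    (hk : UniformGaussianDecay s k) (hs : MeasurableSet s) (hs' : volume s ≠ ⊤) (hp : 1 ≤ p)
    {f : V → ℝ} (hf : MemLp f p) :
    ∫ y, timeIntegral s k y * f y = ∫ t in s, ∫ y, k t y * f y := by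
  simp only [timeIntegral, ← integral_mul_const]
  exact (integral_integral_swap (f := fun t y => k t y * f y)
    (hk.integrable_smul hs hs' hp hf)).symm

lemma IsTestFunction.continuous_partialDeriv {ψ : R3 → ℝ} (hψ : IsTestFunction ψ) (i : Fin 3) :
    Continuous (partialDeriv i ψ) :=
  (hψ.1.continuous_fderiv (by simp)).clm_apply continuous_const

lemma IsTestFunction.hasCompactSupport_partialDeriv {ψ : R3 → ℝ} (hψ : IsTestFunction ψ)
    (i : Fin 3) : HasCompactSupport (partialDeriv i ψ) :=
  hψ.2.fderiv_apply (𝕜 := ℝ) (EuclideanSpace.single i 1)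

lemma IsTestFunction.comp_add_right {ψ : R3 → ℝ} (hψ : IsTestFunction ψ) (y : R3) :
    IsTestFunction fun z => ψ (z + y) :=
  ⟨hψ.1.comp (contDiff_id.add contDiff_const), hψ.2.comp_homeomorph (Homeomorph.addRight y)⟩

lemma partialDeriv_comp_add_right (i : Fin 3) (ψ : R3 → ℝ) (y z : R3) :
    partialDeriv i (fun z => ψ (z + y)) z = partialDeriv i ψ (z + y) := by
  rw [partialDeriv, fderiv_comp_add_right, partialDeriv]

/-- The locally integrable function `g` is the distributional derivative `∂ᵢ φ` of `φ ∈ L¹_loc`. -/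
def HasWeakPartialDeriv (i : Fin 3) (φ g : R3 → ℝ) : Prop :=
  LocallyIntegrable φ volume ∧ LocallyIntegrable g volume ∧
    ∀ ψ : R3 → ℝ, IsTestFunction ψ → ∫ x, g x * ψ x = - ∫ x, φ x * partialDeriv i ψ x

variable {i : Fin 3} {k k' : R3 → ℝ}

lemma integrable_mul_of_hasCompactSupport {φ u : R3 → ℝ} (hφ : LocallyIntegrable φ volume)
    (hu : Continuous u) (hu' : HasCompactSupport u) : Integrable fun x => φ x * u x := by
  simpa only [smul_eq_mul, mul_comm] using hφ.integrable_smul_left_of_hasCompactSupport hu hu'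

lemma hasWeakPartialDeriv_partialDeriv (i : Fin 3) (hk : ContDiff ℝ 1 k) :
    HasWeakPartialDeriv i k (partialDeriv i k) := by
  have hk' : Continuous (partialDeriv i k) :=
    (hk.continuous_fderiv one_ne_zero).clm_apply continuous_const
  refine ⟨hk.continuous.locallyIntegrable, hk'.locallyIntegrable, fun ψ hψ => ?_⟩
  have hparts := integral_mul_fderiv_eq_neg_fderiv_mul_of_integrable
    (integrable_mul_of_hasCompactSupport hk'.locallyIntegrable hψ.1.continuous hψ.2)
    (integrable_mul_of_hasCompactSupport hk.continuous.locallyIntegrable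
      (hψ.continuous_partialDeriv i) (hψ.hasCompactSupport_partialDeriv i))
    (integrable_mul_of_hasCompactSupport hk.continuous.locallyIntegrable hψ.1.continuous hψ.2)
    (fun x _ => hk.differentiable one_ne_zero x)
    (fun x _ => hψ.1.differentiable (by simp) x)
  exact (neg_eq_iff_eq_neg.2 hparts).symm

lemma HasWeakPartialDeriv.neg {φ g : R3 → ℝ} (h : HasWeakPartialDeriv i φ g) :
    HasWeakPartialDeriv i (fun x => -φ x) fun x => -g x :=
  ⟨h.1.neg, h.2.1.neg, fun ψ hψ => by simp only [neg_mul, integral_neg, h.2.2 ψ hψ]⟩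

lemma HasWeakPartialDeriv.sum {ι : Type*} {φ g : ι → R3 → ℝ} (s : Finset ι)
    (h : ∀ j ∈ s, HasWeakPartialDeriv i (φ j) (g j)) :
    HasWeakPartialDeriv i (fun x => ∑ j ∈ s, φ j x) fun x => ∑ j ∈ s, g j x := by
  refine ⟨locallyIntegrable_finsetSum s fun j hj => (h j hj).1,
    locallyIntegrable_finsetSum s fun j hj => (h j hj).2.1, fun ψ hψ => ?_⟩
  simp only [Finset.sum_mul]
  rw [integral_finsetSum _ fun j hj =>
      integrable_mul_of_hasCompactSupport (h j hj).2.1 hψ.1.continuous hψ.2,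
    integral_finsetSum _ fun j hj => integrable_mul_of_hasCompactSupport (h j hj).1
      (hψ.continuous_partialDeriv i) (hψ.hasCompactSupport_partialDeriv i),
    ← Finset.sum_neg_distrib]
  exact Finset.sum_congr rfl fun j hj => (h j hj).2.2 ψ hψ

lemma HasWeakPartialDeriv.convolution (h : HasWeakPartialDeriv i k k') (hk : GaussianDecay k)
    (hk' : GaussianDecay k') (hp : 1 ≤ p) (hp' : p ≠ ⊤) {f : R3 → ℝ} (hf : MemLp f p) :
    HasWeakPartialDeriv i (k ⋆ f) (k' ⋆ f) := by
  refine ⟨(hk.memLp_convolution hp hp' hf).locallyIntegrable hp,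
    (hk'.memLp_convolution hp hp' hf).locallyIntegrable hp, fun ψ hψ => ?_⟩
  rw [hk'.integral_convolution_mul_swap hp hp' hf hψ.1.continuous hψ.2,
    hk.integral_convolution_mul_swap hp hp' hf (hψ.continuous_partialDeriv i)
      (hψ.hasCompactSupport_partialDeriv i), ← integral_neg]
  refine integral_congr_ae (ae_of_all _ fun y => ?_)
  have htranslate := h.2.2 _ (hψ.comp_add_right y)
  simp only [partialDeriv_comp_add_right] at htranslate
  simp only [htranslate, mul_neg]

lemma HasWeakPartialDeriv.timeIntegral {s : Set ℝ} {k k' : ℝ → R3 → ℝ}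
    (hk : UniformGaussianDecay s k) (hk' : UniformGaussianDecay s k') (hs : MeasurableSet s)
    (hs' : volume s ≠ ⊤) (h : ∀ t ∈ s, HasWeakPartialDeriv i (k t) (k' t)) :
    HasWeakPartialDeriv i (timeIntegral s k) (timeIntegral s k') := by
  refine ⟨(hk.gaussianDecay_timeIntegral hs').integrable.locallyIntegrable,
    (hk'.gaussianDecay_timeIntegral hs').integrable.locallyIntegrable, fun ψ hψ => ?_⟩
  rw [hk'.integral_timeIntegral_mul hs hs' le_rfl
      (hψ.1.continuous.memLp_of_hasCompactSupport hψ.2),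
    hk.integral_timeIntegral_mul hs hs' le_rfl
      ((hψ.continuous_partialDeriv i).memLp_of_hasCompactSupport
        (hψ.hasCompactSupport_partialDeriv i)), ← integral_neg]
  exact setIntegral_congr_fun hs fun t ht => (h t ht).2.2 ψ hψ

lemma hasWeakGradient_of_hasWeakPartialDeriv {φ : R3 → ℝ} {G : R3 → R3}
    (h : ∀ i, HasWeakPartialDeriv i φ fun x => G x i) : HasWeakGradient φ G := by
  refine ⟨(h 0).1, locallyIntegrable_iff.2 fun K hK => ?_, fun ψ hψ i => (h i).2.2 ψ hψ⟩
  exact Integrable.of_eval_piLp fun i => (h i).2.1.integrableOn_isCompact hK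

lemma locallyIntegrable_coord {D : R3 → R3} (hD : LocallyIntegrable D volume) (i : Fin 3) :
    LocallyIntegrable (fun x => D x i) volume :=
  locallyIntegrable_iff.2 fun _ hK => (hD.integrableOn_isCompact hK).eval_piLp i

lemma HasWeakCurl.ae_eq {A B B' : R3 → R3} (h : HasWeakCurl A B) (h' : HasWeakCurl A B') :
    B =ᵐ[volume] B' := by
  have hcoord : ∀ i, ∀ᵐ x, B x i = B' x i := fun i =>
    ae_eq_of_integral_contDiff_smul_eq (locallyIntegrable_coord h.2.1 i)
      (locallyIntegrable_coord h'.2.1 i) fun ψ hψ hψ' => by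
        simpa only [smul_eq_mul, mul_comm] using
          (h.2.2 ψ ⟨hψ, hψ'⟩ i).trans (h'.2.2 ψ ⟨hψ, hψ'⟩ i).symm
  filter_upwards [ae_all_iff.2 hcoord] with x hx
  exact PiLp.ext hx

lemma HasWeakCurl.integral_mul_comp_add {A B : R3 → R3} (h : HasWeakCurl A B) {ψ : R3 → ℝ}
    (hψ : IsTestFunction ψ) (i : Fin 3) (z : R3) :
    ∫ y, B y i * ψ (y + z) =
      (∫ y, A y (i + 1) * partialDeriv (i + 2) ψ (y + z)) -
        ∫ y, A y (i + 2) * partialDeriv (i + 1) ψ (y + z) := by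
  have hint : ∀ a b, Integrable fun y => A y a * partialDeriv b ψ (y + z) := fun a b =>
    integrable_mul_of_hasCompactSupport (locallyIntegrable_coord h.1 a)
      ((hψ.continuous_partialDeriv b).comp (continuous_add_const z))
      ((hψ.hasCompactSupport_partialDeriv b).comp_homeomorph (Homeomorph.addRight z))
  rw [h.2.2 _ (hψ.comp_add_right z) i]
  simp only [partialDeriv_comp_add_right]
  rw [integral_sub (hint _ _) (hint _ _), neg_sub]

lemma HasWeakCurl.convolution_ae_eq {A B : R3 → R3} {q : ℝ≥0∞} (h : HasWeakCurl A B)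
    (hp : 1 ≤ p) (hp' : p ≠ ⊤) (hA : MemLp A p) (hq : 1 ≤ q) (hq' : q ≠ ⊤) (hB : MemLp B q)
    {k : R3 → ℝ} {k' : Fin 3 → R3 → ℝ} (hk : GaussianDecay k) (hk' : ∀ i, GaussianDecay (k' i))
    (hkk' : ∀ i, HasWeakPartialDeriv i k (k' i)) (i : Fin 3) :
    (k ⋆ fun y => B y i) =ᵐ[volume] fun x =>
      (k' (i + 1) ⋆ fun y => A y (i + 2)) x - (k' (i + 2) ⋆ fun y => A y (i + 1)) x := by
  have hderiv : ∀ a b, HasWeakPartialDeriv a (k ⋆ fun y => A y b) (k' a ⋆ fun y => A y b) :=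
    fun a b => (hkk' a).convolution hk (hk' a) hp hp' (hA.eval_piLp b)
  refine ae_eq_of_integral_contDiff_smul_eq
    ((hk.memLp_convolution hq hq' (hB.eval_piLp i)).locallyIntegrable hq)
    ((hderiv _ _).2.1.sub (hderiv _ _).2.1) fun ψ hψ hψ' => ?_
  have htest : IsTestFunction ψ := ⟨hψ, hψ'⟩
  have hpair : ∀ a b, Integrable fun z => k z * ∫ y, A y a * partialDeriv b ψ (y + z) :=
    fun a b => by
      simpa only [integral_const_mul] using (hk.integrable_prod_mul_comp_add hp hp'
        (hA.eval_piLp a) (htest.continuous_partialDeriv b)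
        (htest.hasCompactSupport_partialDeriv b)).integral_prod_left
  have hderiv_pair : ∀ a b, ∫ x, (k' b ⋆ fun y => A y a) x * ψ x =
      -∫ z, k z * ∫ y, A y a * partialDeriv b ψ (y + z) := fun a b => by
    rw [(hderiv b a).2.2 ψ htest, hk.integral_convolution_mul hp hp' (hA.eval_piLp a)
      (htest.continuous_partialDeriv b) (htest.hasCompactSupport_partialDeriv b)]
  calc ∫ x, ψ x • (k ⋆ fun y => B y i) x
      = ∫ x, (k ⋆ fun y => B y i) x * ψ x := by simp only [smul_eq_mul, mul_comm]
    _ = (∫ z, k z * ∫ y, A y (i + 1) * partialDeriv (i + 2) ψ (y + z)) -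
          ∫ z, k z * ∫ y, A y (i + 2) * partialDeriv (i + 1) ψ (y + z) := by
        rw [hk.integral_convolution_mul hq hq' (hB.eval_piLp i) hψ.continuous hψ']
        simp only [h.integral_mul_comp_add htest, mul_sub]
        exact integral_sub (hpair _ _) (hpair _ _)
    _ = (∫ x, (k' (i + 1) ⋆ fun y => A y (i + 2)) x * ψ x) -
          ∫ x, (k' (i + 2) ⋆ fun y => A y (i + 1)) x * ψ x := by
        rw [hderiv_pair, hderiv_pair, neg_sub_neg]
    _ = _ := by
        rw [← integral_sub (integrable_mul_of_hasCompactSupport (hderiv _ _).2.1 hψ.continuous hψ')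
          (integrable_mul_of_hasCompactSupport (hderiv _ _).2.1 hψ.continuous hψ')]
        simp only [smul_eq_mul, mul_comm (ψ _), sub_mul]

end WeakDerivative

section HeatDecomposition

variable {p q : ℝ≥0∞} {ε T : ℝ} {A B : R3 → R3}

lemma GaussianDecay.convolution_coord {k : R3 → ℝ} (hk : GaussianDecay k) (hp : 1 ≤ p)
    (hA : MemLp A p) (i : Fin 3) (x : R3) : (k ⋆ A) x i = (k ⋆ fun y => A y i) x := by
  simp only [convolution_lsmul]
  exact eval_integral_piLp (fun j => (hk.convolutionExists hp hA x).eval_piLp j) i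

lemma gaussianDecay_timeIntegral_heatKernelD (j : Fin 3) (hε : 0 < ε) :
    GaussianDecay (timeIntegral (Icc ε T) (heatKernelD j)) :=
  (uniformGaussianDecay_heatKernelD j hε).gaussianDecay_timeIntegral measure_Icc_lt_top.ne

lemma gaussianDecay_timeIntegral_heatKernelDD (i j : Fin 3) (hε : 0 < ε) :
    GaussianDecay (timeIntegral (Icc ε T) (heatKernelDD i j)) :=
  (uniformGaussianDecay_heatKernelDD i j hε).gaussianDecay_timeIntegral measure_Icc_lt_top.ne

lemma hasWeakPartialDeriv_timeIntegral_heatKernelD (i j : Fin 3) (hε : 0 < ε) :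
    HasWeakPartialDeriv i (timeIntegral (Icc ε T) (heatKernelD j))
      (timeIntegral (Icc ε T) (heatKernelDD i j)) := by
  refine HasWeakPartialDeriv.timeIntegral (uniformGaussianDecay_heatKernelD j hε)
    (uniformGaussianDecay_heatKernelDD i j hε) measurableSet_Icc measure_Icc_lt_top.ne
    fun t ht => ?_
  rw [← funext (partialDeriv_heatKernelD i j (hε.trans_le ht.1))]
  exact hasWeakPartialDeriv_partialDeriv i ((contDiff_heatKernelD j t).of_le (by simp))

/-- The potential `-∫ ∇ · e^{tΔ} A dt`, integrated over `ε ≤ t ≤ T`, of the gradient part of the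
heat flow of `A`. -/
noncomputable def heatPotential (ε T : ℝ) (A : R3 → R3) (x : R3) : ℝ :=
  -∑ j, (timeIntegral (Icc ε T) (heatKernelD j) ⋆ fun y => A y j) x

/-- The gradient part `-∫ ∇ (∇ · e^{tΔ} A) dt`, `ε ≤ t ≤ T`, of the heat flow of `A`. -/
noncomputable def heatGradientPart (ε T : ℝ) (A : R3 → R3) (x : R3) : R3 :=
  WithLp.toLp 2 fun i => -∑ j, (timeIntegral (Icc ε T) (heatKernelDD i j) ⋆ fun y => A y j) x

/-- The field `∫ ∇ ∧ e^{tΔ} B dt`, `ε ≤ t ≤ T`; for `B = ∇ ∧ A` it is the divergence-free part of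
the heat flow of `A`. Indices are modulo 3, as in `HasWeakCurl`. -/
noncomputable def heatCurlPart (ε T : ℝ) (B : R3 → R3) (x : R3) : R3 :=
  WithLp.toLp 2 fun i =>
    (timeIntegral (Icc ε T) (heatKernelD (i + 1)) ⋆ B) x (i + 2) -
      (timeIntegral (Icc ε T) (heatKernelD (i + 2)) ⋆ B) x (i + 1)

lemma hasWeakGradient_heatPotential (hε : 0 < ε) (hp : 1 ≤ p) (hp' : p ≠ ⊤) (hA : MemLp A p) :
    HasWeakGradient (heatPotential ε T A) (heatGradientPart ε T A) :=
  hasWeakGradient_of_hasWeakPartialDeriv fun i => (HasWeakPartialDeriv.sum Finset.univ fun j _ =>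
    (hasWeakPartialDeriv_timeIntegral_heatKernelD i j hε).convolution
      (gaussianDecay_timeIntegral_heatKernelD j hε) (gaussianDecay_timeIntegral_heatKernelDD i j hε)
      hp hp' (hA.eval_piLp j)).neg

lemma memLp_heatGradientPart (hε : 0 < ε) (hp : 1 ≤ p) (hp' : p ≠ ⊤) (hA : MemLp A p) :
    MemLp (heatGradientPart ε T A) p := by
  refine MemLp.of_eval_piLp fun i => ?_
  have hterm : ∀ j, MemLp (timeIntegral (Icc ε T) (heatKernelDD i j) ⋆ fun y => A y j) p :=
    fun j => (gaussianDecay_timeIntegral_heatKernelDD i j hε).memLp_convolution hp hp'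
      (hA.eval_piLp j)
  exact (memLp_finsetSum Finset.univ fun j _ => hterm j).neg

lemma continuousOn_heatKernelDD_time (i j : Fin 3) (z : R3) :
    ContinuousOn (fun t => heatKernelDD i j t z) (Ioi 0) := by
  intro t (ht : 0 < t)
  have hcont : ContinuousAt (fun t => heatKernel t z) t := (hasDerivAt_heatKernel ht z).continuousAt
  refine ContinuousAt.continuousWithinAt (ContinuousAt.mul (ContinuousAt.sub ?_ ?_) hcont)
  · exact continuousAt_const.div (by fun_prop) (by positivity)
  · exact continuousAt_const.div (by fun_prop) (by positivity)

lemma sum_timeIntegral_heatKernelDD (hε : 0 < ε) (hT : ε ≤ T) (z : R3) :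
    ∑ j, timeIntegral (Icc ε T) (heatKernelDD j j) z = heatKernel T z - heatKernel ε z := by
  have hcont : ∀ j : Fin 3, ContinuousOn (fun t => heatKernelDD j j t z) (Icc ε T) := fun j =>
    (continuousOn_heatKernelDD_time j j z).mono fun t ht => hε.trans_le ht.1
  simp only [timeIntegral]
  rw [← integral_finsetSum _ fun j _ => (hcont j).integrableOn_Icc, integral_Icc_eq_integral_Ioc,
    ← intervalIntegral.integral_of_le hT]
  refine intervalIntegral.integral_eq_sub_of_hasDerivAt (f := fun t => heatKernel t z)
    (fun t ht => ?_) ?_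
  · rw [uIcc_of_le hT] at ht
    exact hasDerivAt_heatKernel (hε.trans_le ht.1) z
  · refine ContinuousOn.intervalIntegrable ?_
    rw [uIcc_of_le hT]
    exact continuousOn_finsetSum _ fun j _ => hcont j

lemma sum_timeIntegral_heatKernelDD_convolution {F : Type*} [NormedAddCommGroup F]
    [NormedSpace ℝ F] (hε : 0 < ε) (hT : ε ≤ T) (hp : 1 ≤ p) {f : R3 → F} (hf : MemLp f p)
    (x : R3) : ∑ j, (timeIntegral (Icc ε T) (heatKernelDD j j) ⋆ f) x =
      (heatKernel T ⋆ f) x - (heatKernel ε ⋆ f) x := by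
  simp only [convolution]
  rw [← integral_finsetSum _ fun j _ =>
      (gaussianDecay_timeIntegral_heatKernelDD j j hε).convolutionExists hp hf x,
    ← integral_sub ((gaussianDecay_heatKernel (hε.trans_le hT)).convolutionExists hp hf x)
      ((gaussianDecay_heatKernel hε).convolutionExists hp hf x)]
  simp only [ContinuousLinearMap.lsmul_apply, ← Finset.sum_smul,
    sum_timeIntegral_heatKernelDD hε hT, sub_smul]

lemma heatCurlPart_ae_eq (h : HasWeakCurl A B) (hε : 0 < ε) (hp : 1 ≤ p) (hp' : p ≠ ⊤)
    (hA : MemLp A p) (hq : 1 ≤ q) (hq' : q ≠ ⊤) (hB : MemLp B q) (i : Fin 3) :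
    (fun x => heatCurlPart ε T B x i) =ᵐ[volume] fun x =>
      ∑ j, ((timeIntegral (Icc ε T) (heatKernelDD i j) ⋆ fun y => A y j) x -
        (timeIntegral (Icc ε T) (heatKernelDD j j) ⋆ fun y => A y i) x) := by
  have hconv : ∀ j l, (timeIntegral (Icc ε T) (heatKernelD j) ⋆ fun y => B y l) =ᵐ[volume] _ :=
    fun j => h.convolution_ae_eq hp hp' hA hq hq' hB (gaussianDecay_timeIntegral_heatKernelD j hε)
      (gaussianDecay_timeIntegral_heatKernelDD · j hε)
      (hasWeakPartialDeriv_timeIntegral_heatKernelD · j hε)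
  obtain ⟨h12, h21, h11, h22⟩ : i + 1 + 2 = i ∧ i + 2 + 1 = i ∧ i + 1 + 1 = i + 2 ∧
      i + 2 + 2 = i + 1 := by decide +revert
  have hsum : ∀ g : Fin 3 → ℝ, ∑ j, g j = g i + g (i + 1) + g (i + 2) := fun g => by
    rw [← Equiv.sum_comp (Equiv.addLeft i), Fin.sum_univ_three]
    simp only [Equiv.coe_addLeft, add_zero]
  filter_upwards [hconv (i + 1) (i + 2), hconv (i + 2) (i + 1)] with x hx₁ hx₂
  simp only [heatCurlPart, hx₁, hx₂, hsum, h12, h21, h11, h22,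
    (gaussianDecay_timeIntegral_heatKernelD _ hε).convolution_coord hq hB]
  ring

lemma heatSemigroup_sub_heatSemigroup_ae_eq (h : HasWeakCurl A B) (hε : 0 < ε) (hT : ε ≤ T)
    (hp : 1 ≤ p) (hp' : p ≠ ⊤) (hA : MemLp A p) (hq : 1 ≤ q) (hq' : q ≠ ⊤) (hB : MemLp B q) :
    heatSemigroup ε A - heatSemigroup T A =ᵐ[volume]
      heatGradientPart ε T A + heatCurlPart ε T B := by
  filter_upwards [ae_all_iff.2 (heatCurlPart_ae_eq (T := T) h hε hp hp' hA hq hq' hB)] with x hcurl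
  ext i
  have hdiff := sum_timeIntegral_heatKernelDD_convolution hε hT hp (hA.eval_piLp i) x
  simp only [Pi.sub_apply, Pi.add_apply, PiLp.sub_apply, PiLp.add_apply, hcurl i,
    heatSemigroup_eq_convolution, heatGradientPart, Finset.sum_sub_distrib, hdiff,
    (gaussianDecay_heatKernel hε).convolution_coord hp hA,
    (gaussianDecay_heatKernel (hε.trans_le hT)).convolution_coord hp hA]
  ring

end HeatDecomposition

section Hedberg

lemma lt_heatKernel_iff {t c : ℝ} (ht : 0 < t) (hc : 0 < c) (z : R3) : c < heatKernel t z ↔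
    ‖z‖ < √(-(4 * t) * Real.log (c / (4 * Real.pi * t) ^ (-(3 / 2) : ℝ))) := by
  have hamp : 0 < (4 * Real.pi * t) ^ (-(3 / 2) : ℝ) := by positivity
  rw [heatKernel, ← div_lt_iff₀' hamp, Real.lt_sqrt (norm_nonneg z),
    ← Real.log_lt_iff_lt_exp (by positivity), neg_div, lt_neg, div_lt_iff₀ (by positivity)]
  ring_nf

lemma exists_setOf_lt_heatKernel_sub_eq_ball {t c : ℝ} (ht : 0 < t) (hc : 0 < c) (x : R3) :
    ∃ r, {y | c < heatKernel t (x - y)} = ball x r :=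
  ⟨_, by ext y; rw [mem_ofPred_eq, lt_heatKernel_iff ht hc, mem_ball', dist_eq_norm]⟩

lemma lintegral_mul_heatKernel_le_maximalFunction {f : R3 → ℝ≥0∞} (hf : AEMeasurable f) {t : ℝ}
    (ht : 0 < t) (x : R3) :
    ∫⁻ y, f y * ‖heatKernel t (x - y)‖ₑ ≤ maximalFunction volume f x := by
  have hmass : ∫⁻ y, ENNReal.ofReal (heatKernel t (x - y)) = 1 := by
    simp only [← enorm_heatKernel ht]
    rw [lintegral_sub_left_eq_self fun z => ‖heatKernel t z‖ₑ, lintegral_enorm_heatKernel ht]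
  simp only [enorm_heatKernel ht]
  simpa only [hmass, mul_one] using
    lintegral_mul_le_maximalFunction_mul hf (k := fun y => heatKernel t (x - y))
      (measurable_heatKernel.of_uncurry_left.comp (measurable_const_sub x))
      (fun y => (heatKernel_pos ht (x - y)).le)
      (fun c hc => exists_setOf_lt_heatKernel_sub_eq_ball ht hc x)

lemma enorm_heatKernelD_le (j : Fin 3) {t : ℝ} (ht : 0 < t) (z : R3) :
    ‖heatKernelD j t z‖ₑ ≤
      ENNReal.ofReal (3 * t ^ (-(1 / 2) : ℝ)) * ‖heatKernel (2 * t) z‖ₑ := by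
  rw [enorm_heatKernel (by positivity), ← ENNReal.ofReal_mul (by positivity),
    Real.enorm_eq_ofReal_abs]
  exact ENNReal.ofReal_le_ofReal (abs_heatKernelD_le j ht z)

variable {F : Type*} [NormedAddCommGroup F] [NormedSpace ℝ F]

lemma enorm_heatKernelD_convolution_le_maximalFunction (j : Fin 3) {t : ℝ} (ht : 0 < t)
    {f : R3 → F} (hf : AEStronglyMeasurable f volume) (x : R3) :
    ‖(heatKernelD j t ⋆ f) x‖ₑ ≤ ENNReal.ofReal (t ^ (-(1 / 2) : ℝ)) *
      (3 * maximalFunction volume (fun y => ‖f y‖ₑ) x) := by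
  rw [convolution_lsmul_swap]
  calc ‖∫ y, heatKernelD j t (x - y) • f y‖ₑ
      ≤ ∫⁻ y, ‖heatKernelD j t (x - y) • f y‖ₑ := enorm_integral_le_lintegral_enorm _
    _ ≤ ∫⁻ y, ENNReal.ofReal (3 * t ^ (-(1 / 2) : ℝ)) *
          (‖f y‖ₑ * ‖heatKernel (2 * t) (x - y)‖ₑ) := by
        refine lintegral_mono fun y => ?_
        rw [enorm_smul, mul_left_comm, mul_comm]
        gcongr
        exact enorm_heatKernelD_le j ht _
    _ ≤ ENNReal.ofReal (3 * t ^ (-(1 / 2) : ℝ)) *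
          maximalFunction volume (fun y => ‖f y‖ₑ) x := by
        rw [lintegral_const_mul' _ _ ENNReal.ofReal_ne_top]
        gcongr
        exact lintegral_mul_heatKernel_le_maximalFunction hf.enorm (by positivity) x
    _ = _ := by
        rw [mul_comm 3, ENNReal.ofReal_mul (by positivity), ENNReal.ofReal_ofNat, mul_assoc]

lemma enorm_convolution_le_lintegral_mul_eLpNorm_top {k : R3 → ℝ} (hk : Measurable k) (f : R3 → F)
    (x : R3) : ‖(k ⋆ f) x‖ₑ ≤ (∫⁻ y, ‖k y‖ₑ) * eLpNorm f ⊤ volume := by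
  have hf : ∀ᵐ y, ‖f (x - y)‖ₑ ≤ eLpNorm f ⊤ volume := by
    rw [eLpNorm_exponent_top]
    exact (quasiMeasurePreserving_sub_left volume x).ae (enorm_ae_le_eLpNormEssSup f volume)
  rw [convolution_lsmul, ← lintegral_mul_const _ hk.enorm]
  refine (enorm_integral_le_lintegral_enorm _).trans (lintegral_mono_ae ?_)
  filter_upwards [hf] with y hy
  rw [enorm_smul]
  gcongr

lemma lintegral_enorm_heatKernelD_le (j : Fin 3) {t : ℝ} (ht : 0 < t) :
    ∫⁻ y, ‖heatKernelD j t y‖ₑ ≤ ENNReal.ofReal (3 * t ^ (-(1 / 2) : ℝ)) := by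
  refine (lintegral_mono (enorm_heatKernelD_le j ht)).trans_eq ?_
  rw [lintegral_const_mul' _ _ ENNReal.ofReal_ne_top, lintegral_enorm_heatKernel (by positivity),
    mul_one]

lemma eLpNorm_heatSemigroup_top_le (B : R3 → R3) {t : ℝ} (ht : 0 < t) :
    eLpNorm (heatSemigroup t B) ⊤ volume ≤ ENNReal.ofReal t⁻¹ * heatBesovNorm B := by
  rw [ENNReal.ofReal_inv_of_pos ht, ← ENNReal.div_eq_inv_mul,
    ENNReal.le_div_iff_mul_le (.inl (by simpa using ht)) (.inl ENNReal.ofReal_ne_top), mul_comm]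
  exact le_iSup₂_of_le t ht le_rfl

lemma enorm_heatKernelD_convolution_le_heatBesovNorm (j : Fin 3) {t : ℝ} (ht : 0 < t)
    {p : ℝ≥0∞} (hp : 1 ≤ p) (hp' : p ≠ ⊤) {B : R3 → R3} (hB : MemLp B p) (x : R3) :
    ‖(heatKernelD j t ⋆ B) x‖ₑ ≤
      ENNReal.ofReal (t ^ (-(3 / 2) : ℝ)) * (9 * heatBesovNorm B) := by
  obtain ⟨s, hs, rfl⟩ : ∃ s, 0 < s ∧ t = 2 * s := ⟨t / 2, by positivity, by ring⟩
  have hpow : s ^ (-(3 / 2) : ℝ) = s ^ (-(1 / 2) : ℝ) * s⁻¹ := by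
    rw [← Real.rpow_neg_one s, ← Real.rpow_add hs]
    norm_num
  have htwo : 1 ≤ 3 * (2 : ℝ) ^ (-(3 / 2) : ℝ) := by
    have hsq : (2 : ℝ) ^ (3 / 2 : ℝ) ≤ 3 := by
      refine (sq_le_sq₀ (by positivity) (by norm_num)).1 ?_
      rw [← Real.rpow_natCast, ← Real.rpow_mul (by norm_num)]
      norm_num
    rwa [Real.rpow_neg (by norm_num), ← div_eq_mul_inv, one_le_div₀ (by positivity)]
  have hconst : 3 * s ^ (-(1 / 2) : ℝ) * s⁻¹ ≤ (2 * s) ^ (-(3 / 2) : ℝ) * 9 := by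
    rw [mul_assoc, ← hpow, Real.mul_rpow (by norm_num) hs.le]
    nlinarith [mul_le_mul_of_nonneg_right htwo (Real.rpow_nonneg hs.le (-(3 / 2)))]
  rw [heatKernelD_two_mul_convolution j hs hp hp' hB, ← heatSemigroup_eq_convolution]
  calc ‖(heatKernelD j s ⋆ heatSemigroup s B) x‖ₑ
      ≤ (∫⁻ y, ‖heatKernelD j s y‖ₑ) * eLpNorm (heatSemigroup s B) ⊤ volume :=
        enorm_convolution_le_lintegral_mul_eLpNorm_top (gaussianDecay_heatKernelD j hs).1 _ x
    _ ≤ ENNReal.ofReal (3 * s ^ (-(1 / 2) : ℝ)) * (ENNReal.ofReal s⁻¹ * heatBesovNorm B) := by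
        gcongr
        · exact lintegral_enorm_heatKernelD_le j hs
        · exact eLpNorm_heatSemigroup_top_le B hs
    _ ≤ ENNReal.ofReal ((2 * s) ^ (-(3 / 2) : ℝ) * 9) * heatBesovNorm B := by
        rw [← mul_assoc, ← ENNReal.ofReal_mul (by positivity)]
        gcongr
    _ = _ := by rw [ENNReal.ofReal_mul (by positivity), ENNReal.ofReal_ofNat, mul_assoc]

end Hedberg

section GeometricMean

variable {h : ℝ → ℝ≥0∞} {m K : ℝ≥0∞}

lemma setLIntegral_Ioc_zero_rpow_neg_half {τ : ℝ} (hτ : 0 < τ) :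
    ∫⁻ t in Ioc 0 τ, ENNReal.ofReal (t ^ (-(1 / 2) : ℝ)) = ENNReal.ofReal (2 * √τ) := by
  have hint : IntegrableOn (fun t : ℝ => t ^ (-(1 / 2) : ℝ)) (Ioc 0 τ) :=
    (intervalIntegrable_iff_integrableOn_Ioc_of_le hτ.le).1
      (intervalIntegral.intervalIntegrable_rpow' (by norm_num))
  rw [← ofReal_integral_eq_lintegral_ofReal hint
      ((ae_restrict_mem measurableSet_Ioc).mono fun t ht => Real.rpow_nonneg ht.1.le _),
    ← intervalIntegral.integral_of_le hτ.le, integral_rpow (.inl (by norm_num)),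
    show -(1 / 2) + 1 = (1 / 2 : ℝ) by norm_num, Real.zero_rpow (by norm_num), Real.sqrt_eq_rpow]
  ring_nf

lemma setLIntegral_Ioi_rpow_neg_three_halves {τ : ℝ} (hτ : 0 < τ) :
    ∫⁻ t in Ioi τ, ENNReal.ofReal (t ^ (-(3 / 2) : ℝ)) = ENNReal.ofReal (2 / √τ) := by
  have hint : IntegrableOn (fun t : ℝ => t ^ (-(3 / 2) : ℝ)) (Ioi τ) :=
    integrableOn_Ioi_rpow_of_lt (by norm_num) hτ
  rw [← ofReal_integral_eq_lintegral_ofReal hint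
      ((ae_restrict_mem measurableSet_Ioi).mono fun t ht => Real.rpow_nonneg (hτ.trans ht).le _),
    integral_Ioi_rpow_of_lt (by norm_num) hτ, show -(3 / 2) + 1 = (-(1 / 2) : ℝ) by norm_num,
    Real.rpow_neg hτ.le, Real.sqrt_eq_rpow]
  congr 1
  field_simp

lemma setLIntegral_Ioi_zero_le_add {τ : ℝ} (hτ : 0 < τ)
    (hm : ∀ t, 0 < t → h t ≤ ENNReal.ofReal (t ^ (-(1 / 2) : ℝ)) * m)
    (hK : ∀ t, 0 < t → h t ≤ ENNReal.ofReal (t ^ (-(3 / 2) : ℝ)) * K) :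
    ∫⁻ t in Ioi (0 : ℝ), h t ≤ ENNReal.ofReal (2 * √τ) * m + ENNReal.ofReal (2 / √τ) * K := by
  rw [← Ioc_union_Ioi_eq_Ioi hτ.le, ← setLIntegral_Ioc_zero_rpow_neg_half hτ,
    ← setLIntegral_Ioi_rpow_neg_three_halves hτ, ← lintegral_mul_const _ (by fun_prop),
    ← lintegral_mul_const _ (by fun_prop)]
  exact (lintegral_union_le _ _ _).trans (add_le_add
    (setLIntegral_mono' measurableSet_Ioc fun t ht => hm t ht.1)
    (setLIntegral_mono' measurableSet_Ioi fun t ht => hK t (hτ.trans ht)))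

lemma setLIntegral_Ioi_zero_le_geometric_mean
    (hm : ∀ t, 0 < t → h t ≤ ENNReal.ofReal (t ^ (-(1 / 2) : ℝ)) * m)
    (hK : ∀ t, 0 < t → h t ≤ ENNReal.ofReal (t ^ (-(3 / 2) : ℝ)) * K) :
    ∫⁻ t in Ioi (0 : ℝ), h t ≤ 4 * (m * K) ^ (1 / 2 : ℝ) := by
  rcases eq_or_ne m 0 with rfl | hm0
  · refine (setLIntegral_mono' measurableSet_Ioi hm).trans ?_
    simp only [mul_zero, lintegral_zero, zero_le]
  rcases eq_or_ne K 0 with rfl | hK0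
  · refine (setLIntegral_mono' measurableSet_Ioi hK).trans ?_
    simp only [mul_zero, lintegral_zero, zero_le]
  rcases eq_or_ne m ⊤ with rfl | hmt
  · simp [ENNReal.top_mul hK0]
  rcases eq_or_ne K ⊤ with rfl | hKt
  · simp [ENNReal.mul_top hm0]
  obtain ⟨a, rfl⟩ : ∃ a : ℝ≥0, m = a ^ 2 := ⟨NNReal.sqrt m.toNNReal, by
    rw [← ENNReal.coe_pow, NNReal.sq_sqrt, ENNReal.coe_toNNReal hmt]⟩
  obtain ⟨b, rfl⟩ : ∃ b : ℝ≥0, K = b ^ 2 := ⟨NNReal.sqrt K.toNNReal, by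
    rw [← ENNReal.coe_pow, NNReal.sq_sqrt, ENNReal.coe_toNNReal hKt]⟩
  have ha : 0 < a := pos_of_ne_zero (by simpa using hm0)
  have hb : 0 < b := pos_of_ne_zero (by simpa using hK0)
  have hsqrt : √(((b / a : ℝ≥0) : ℝ) ^ 2) = (b / a : ℝ≥0) := Real.sqrt_sq (by positivity)
  have hleft : ((b / a : ℝ≥0) : ℝ≥0∞) * a ^ 2 = a * b := by norm_cast; field_simp
  have hright : (((b / a)⁻¹ : ℝ≥0) : ℝ≥0∞) * b ^ 2 = a * b := by norm_cast; field_simp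
  refine (setLIntegral_Ioi_zero_le_add (show 0 < ((b / a : ℝ≥0) : ℝ) ^ 2 by positivity)
    hm hK).trans_eq ?_
  rw [hsqrt, div_eq_mul_inv 2, ENNReal.ofReal_mul (by norm_num), ENNReal.ofReal_mul (by norm_num),
    ← NNReal.coe_inv, ENNReal.ofReal_coe_nnreal, ENNReal.ofReal_coe_nnreal, mul_assoc, hleft,
    mul_assoc, hright, ENNReal.ofReal_ofNat, ← mul_pow, ← ENNReal.rpow_two, ← ENNReal.rpow_mul]
  norm_num
  ring

end GeometricMean

section CurlPart

lemma enorm_timeIntegral_heatKernelD_convolution_le (j : Fin 3) {ε : ℝ} (hε : 0 < ε) (T : ℝ)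
    {p : ℝ≥0∞} (hp : 1 ≤ p) (hp' : p ≠ ⊤) {B : R3 → R3} (hB : MemLp B p) (x : R3) :
    ‖(timeIntegral (Icc ε T) (heatKernelD j) ⋆ B) x‖ₑ ≤
      24 * (maximalFunction volume (fun y => ‖B y‖ₑ) x * heatBesovNorm B) ^ (1 / 2 : ℝ) := by
  set M := maximalFunction volume (fun y => ‖B y‖ₑ) x
  calc ‖(timeIntegral (Icc ε T) (heatKernelD j) ⋆ B) x‖ₑ
      = ‖∫ t in Icc ε T, (heatKernelD j t ⋆ B) x‖ₑ := by
        rw [(uniformGaussianDecay_heatKernelD j hε).timeIntegral_convolution measurableSet_Icc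
          measure_Icc_lt_top.ne hp hB]
    _ ≤ ∫⁻ t in Ioi 0, ‖(heatKernelD j t ⋆ B) x‖ₑ := (enorm_integral_le_lintegral_enorm _).trans
        (lintegral_mono_set fun t ht => hε.trans_le ht.1)
    _ ≤ 4 * (3 * M * (9 * heatBesovNorm B)) ^ (1 / 2 : ℝ) :=
        setLIntegral_Ioi_zero_le_geometric_mean
          (fun t ht => enorm_heatKernelD_convolution_le_maximalFunction j ht hB.1 x)
          (fun t ht => enorm_heatKernelD_convolution_le_heatBesovNorm j ht hp hp' hB x)
    _ ≤ 4 * (6 ^ (2 : ℝ) * (M * heatBesovNorm B)) ^ (1 / 2 : ℝ) := by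
        rw [mul_mul_mul_comm]
        gcongr
        norm_num
    _ = 24 * (M * heatBesovNorm B) ^ (1 / 2 : ℝ) := by
        rw [ENNReal.mul_rpow_of_nonneg _ _ (by norm_num), ← ENNReal.rpow_mul,
          show (2 : ℝ) * (1 / 2) = 1 by norm_num, ENNReal.rpow_one, ← mul_assoc]
        norm_num

lemma enorm_le_sum_enorm_coord {ι : Type*} [Fintype ι] (z : EuclideanSpace ℝ ι) :
    ‖z‖ₑ ≤ ∑ i, ‖z i‖ₑ := by
  classical
  calc ‖z‖ₑ = ‖∑ i, z i • EuclideanSpace.basisFun ι ℝ i‖ₑ := by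
        conv_lhs => rw [← (EuclideanSpace.basisFun ι ℝ).sum_repr z]
        simp only [EuclideanSpace.basisFun_repr]
    _ ≤ ∑ i, ‖z i • EuclideanSpace.basisFun ι ℝ i‖ₑ := enorm_sum_le _ _
    _ = ∑ i, ‖z i‖ₑ := by
        simp only [enorm_smul, OrthonormalBasis.enorm_eq_one, mul_one]

lemma enorm_coord_le {ι : Type*} [Fintype ι] (z : EuclideanSpace ℝ ι) (i : ι) : ‖z i‖ₑ ≤ ‖z‖ₑ :=
  enorm_le_iff_norm_le.2 (PiLp.norm_apply_le z i)

lemma enorm_heatCurlPart_le {ε : ℝ} (hε : 0 < ε) (T : ℝ) {p : ℝ≥0∞} (hp : 1 ≤ p) (hp' : p ≠ ⊤)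
    {B : R3 → R3} (hB : MemLp B p) (x : R3) : ‖heatCurlPart ε T B x‖ₑ ≤
      144 * (maximalFunction volume (fun y => ‖B y‖ₑ) x * heatBesovNorm B) ^ (1 / 2 : ℝ) := by
  set a := (maximalFunction volume (fun y => ‖B y‖ₑ) x * heatBesovNorm B) ^ (1 / 2 : ℝ)
  have hcoord : ∀ j i, ‖(timeIntegral (Icc ε T) (heatKernelD j) ⋆ B) x i‖ₑ ≤ 24 * a := fun j i =>
    (enorm_coord_le _ i).trans (enorm_timeIntegral_heatKernelD_convolution_le j hε T hp hp' hB x)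
  calc ‖heatCurlPart ε T B x‖ₑ ≤ ∑ i, ‖heatCurlPart ε T B x i‖ₑ := enorm_le_sum_enorm_coord _
    _ ≤ ∑ _i : Fin 3, (24 * a + 24 * a) := Finset.sum_le_sum fun i _ =>
        enorm_sub_le.trans (add_le_add (hcoord _ _) (hcoord _ _))
    _ = 144 * a := by
        rw [Fin.sum_const, nsmul_eq_mul]
        ring

lemma exists_eLpNorm_le_of_enorm_le_maximalFunction_mul {E : Type*} [NormedAddCommGroup E]
    [NormedSpace ℝ E] [FiniteDimensional ℝ E] [Nontrivial E] [MeasurableSpace E] [BorelSpace E]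
    (μ : Measure E) [μ.IsAddHaarMeasure] {F G : Type*} [NormedAddCommGroup F]
    [NormedAddCommGroup G] {p : ℝ≥0∞} (hp : 1 < p) (hp' : p ≠ ⊤) :
    ∃ C : ℝ≥0, ∀ (f : E → F) (g : E → G) (K : ℝ≥0∞), AEStronglyMeasurable f μ →
      (∀ x, ‖g x‖ₑ ≤ (maximalFunction μ (fun y => ‖f y‖ₑ) x * K) ^ (1 / 2 : ℝ)) →
      eLpNorm g (2 * p) μ ≤ C * eLpNorm f p μ ^ (1 / 2 : ℝ) * K ^ (1 / 2 : ℝ) := by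
  have hr : 1 < p.toReal := by simpa using (ENNReal.toReal_lt_toReal ENNReal.one_ne_top hp').2 hp
  have hp0 : p ≠ 0 := (zero_lt_one.trans hp).ne'
  obtain ⟨C, hC⟩ := exists_lintegral_maximalFunction_rpow_le μ hr
  refine ⟨C ^ (2 * p).toReal⁻¹, fun f g K hf hg => ?_⟩
  have h2p : 0 < (2 * p).toReal := by simp only [ENNReal.toReal_mul, ENNReal.toReal_ofNat]; linarith
  rw [← ENNReal.rpow_le_rpow_iff h2p,
    eLpNorm_rpow_toReal (mul_ne_zero two_ne_zero hp0) (ENNReal.mul_ne_top ENNReal.ofNat_ne_top hp')]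
  have hhalf : (1 / 2 : ℝ) * (2 * p).toReal = p.toReal := by simp
  calc ∫⁻ x, ‖g x‖ₑ ^ (2 * p).toReal ∂μ
      ≤ ∫⁻ x, maximalFunction μ (fun y => ‖f y‖ₑ) x ^ p.toReal * K ^ p.toReal ∂μ := by
        refine lintegral_mono fun x => ?_
        refine (ENNReal.rpow_le_rpow (hg x) h2p.le).trans_eq ?_
        rw [← ENNReal.rpow_mul, hhalf, ENNReal.mul_rpow_of_nonneg _ _ (by positivity)]
    _ = (∫⁻ x, maximalFunction μ (fun y => ‖f y‖ₑ) x ^ p.toReal ∂μ) * K ^ p.toReal :=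
        lintegral_mul_const _ ((measurable_maximalFunction hf.enorm).pow_const _)
    _ ≤ C * eLpNorm f p μ ^ p.toReal * K ^ p.toReal := by
        rw [eLpNorm_rpow_toReal hp0 hp']
        exact mul_le_mul_left (hC _ hf.enorm) _
    _ = _ := by
        rw [ENNReal.mul_rpow_of_nonneg _ _ h2p.le, ENNReal.mul_rpow_of_nonneg _ _ h2p.le,
          ← ENNReal.rpow_mul, ← ENNReal.rpow_mul, hhalf,
          ENNReal.coe_rpow_of_nonneg _ (by positivity), ← ENNReal.rpow_mul,
          inv_mul_cancel₀ h2p.ne', ENNReal.rpow_one]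

lemma exists_eLpNorm_heatCurlPart_le {p : ℝ≥0∞} (hp : 1 < p) (hp' : p ≠ ⊤) :
    ∃ C : ℝ≥0, ∀ ε T : ℝ, 0 < ε → ∀ B : R3 → R3, MemLp B p →
      eLpNorm (heatCurlPart ε T B) (2 * p) volume ≤
        C * eLpNorm B p volume ^ (1 / 2 : ℝ) * heatBesovNorm B ^ (1 / 2 : ℝ) := by
  obtain ⟨C, hC⟩ := exists_eLpNorm_le_of_enorm_le_maximalFunction_mul (volume : Measure R3)
    (F := R3) (G := R3) hp hp'
  have hpow (a : ℝ≥0∞) : (144 ^ (2 : ℝ) * a) ^ (1 / 2 : ℝ) = 144 * a ^ (1 / 2 : ℝ) := by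
    rw [ENNReal.mul_rpow_of_nonneg _ _ (by norm_num), ← ENNReal.rpow_mul,
      show (2 : ℝ) * (1 / 2) = 1 by norm_num, ENNReal.rpow_one]
  refine ⟨C * 144, fun ε T hε B hB => ?_⟩
  refine (hC B _ (144 ^ (2 : ℝ) * heatBesovNorm B) hB.1 fun x => ?_).trans_eq ?_
  · rw [mul_left_comm, hpow]
    exact enorm_heatCurlPart_le hε T hp.le hp' hB x
  · rw [hpow]
    push_cast
    ring

end CurlPart

section Gauge

variable {A B : R3 → R3} {q : ℝ≥0∞}

lemma gaugeL3Seminorm_le_eLpNorm_sub {φ : R3 → ℝ} {G : R3 → R3} (hφ : HasWeakGradient φ G)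
    (hG : MemLp G 3 volume) : gaugeL3Seminorm A ≤ eLpNorm (fun x => A x - G x) 3 volume :=
  iInf_le_of_le φ (iInf_le_of_le G (iInf₂_le_of_le hφ hG le_rfl))

lemma memLp_heatCurlPart {ε : ℝ} (hε : 0 < ε) (T : ℝ) (hq : 1 ≤ q) (hq' : q ≠ ⊤)
    (hB : MemLp B q) : MemLp (heatCurlPart ε T B) q := by
  have hconv : ∀ j, MemLp (timeIntegral (Icc ε T) (heatKernelD j) ⋆ B) q := fun j =>
    (gaussianDecay_timeIntegral_heatKernelD j hε).memLp_convolution hq hq' hB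
  exact MemLp.of_eval_piLp fun i =>
    ((hconv (i + 1)).eval_piLp (i + 2)).sub ((hconv (i + 2)).eval_piLp (i + 1))

lemma gaugeL3Seminorm_le_add (h : HasWeakCurl A B) (hA : MemLp A 3) (hq : 1 ≤ q) (hq' : q ≠ ⊤)
    (hB : MemLp B q) {ε T : ℝ} (hε : 0 < ε) (hT : ε ≤ T) :
    gaugeL3Seminorm A ≤ eLpNorm (fun x => A x - heatSemigroup ε A x) 3 volume +
      eLpNorm (heatSemigroup T A) 3 volume + eLpNorm (heatCurlPart ε T B) 3 volume := by
  have h3 : (1 : ℝ≥0∞) ≤ 3 := by norm_num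
  have h3' : (3 : ℝ≥0∞) ≠ ⊤ := ENNReal.ofNat_ne_top
  have hheat : ∀ t, 0 < t → MemLp (heatSemigroup t A) 3 := fun t ht => by
    rw [heatSemigroup_eq_convolution]
    exact (gaussianDecay_heatKernel ht).memLp_convolution h3 h3' hA
  have hG : MemLp (heatGradientPart ε T A) 3 := memLp_heatGradientPart hε h3 h3' hA
  have hstart := hA.sub (hheat ε hε)
  have hend := hheat T (hε.trans_le hT)
  have hdecomp : (fun x => A x - heatGradientPart ε T A x) =ᵐ[volume]
      (A - heatSemigroup ε A) + heatSemigroup T A + heatCurlPart ε T B := by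
    filter_upwards [heatSemigroup_sub_heatSemigroup_ae_eq h hε hT h3 h3' hA hq hq' hB] with x hx
    simp only [Pi.sub_apply, Pi.add_apply] at hx ⊢
    rw [sub_add, hx]
    abel
  calc gaugeL3Seminorm A ≤ eLpNorm (fun x => A x - heatGradientPart ε T A x) 3 volume :=
        gaugeL3Seminorm_le_eLpNorm_sub (hasWeakGradient_heatPotential hε h3 h3' hA) hG
    _ = eLpNorm ((A - heatSemigroup ε A) + heatSemigroup T A + heatCurlPart ε T B) 3 volume :=
        eLpNorm_congr_ae hdecomp
    _ ≤ _ := (eLpNorm_add_le (hstart.add hend).1 (memLp_heatCurlPart hε T hq hq' hB).1 h3).trans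
        (add_le_add_left (eLpNorm_add_le hstart.1 hend.1 h3) _)

lemma gaugeL3Seminorm_le_of_forall_eLpNorm_heatCurlPart_le (h : HasWeakCurl A B) (hA : MemLp A 3)
    (hq : 1 ≤ q) (hq' : q ≠ ⊤) (hB : MemLp B q) {R : ℝ≥0∞}
    (hR : ∀ ε T : ℝ, 0 < ε → eLpNorm (heatCurlPart ε T B) 3 volume ≤ R) :
    gaugeL3Seminorm A ≤ R := by
  have h3 : (1 : ℝ≥0∞) < 3 := by norm_num
  have h3' : (3 : ℝ≥0∞) ≠ ⊤ := ENNReal.ofNat_ne_top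
  have hfixed : ∀ ε > 0, gaugeL3Seminorm A ≤
      eLpNorm (fun x => A x - heatSemigroup ε A x) 3 volume + R := by
    intro ε hε
    have hlim := ((tendsto_eLpNorm_heatKernel_convolution_atTop h3 h3' hA).const_add
      (eLpNorm (fun x => A x - heatSemigroup ε A x) 3 volume)).add_const R
    rw [add_zero] at hlim
    refine ge_of_tendsto hlim ?_
    filter_upwards [eventually_ge_atTop ε] with T hT
    rw [← heatSemigroup_eq_convolution]
    exact (gaugeL3Seminorm_le_add h hA hq hq' hB hε hT).trans (add_le_add_right (hR ε T hε) _)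
  have hlim := (tendsto_eLpNorm_sub_heatKernel_convolution h3.le h3' hA).add_const R
  rw [zero_add] at hlim
  refine ge_of_tendsto hlim ?_
  filter_upwards [self_mem_nhdsWithin] with ε hε
  simpa only [heatSemigroup_eq_convolution] using hfixed ε hε

end Gauge

theorem proposition6 :
    ∃ C : ℝ≥0, ∀ A ∈ spaceY, ∀ B : R3 → R3, HasWeakCurl A B →
      gaugeL3Seminorm A ≤
        C * eLpNorm B (3 / 2) volume ^ (1 / 2 : ℝ) * heatBesovNorm B ^ (1 / 2 : ℝ) := by
  have hp : (1 : ℝ≥0∞) < 3 / 2 := by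
    rw [ENNReal.lt_div_iff_mul_lt (by simp) (by simp)]
    norm_num
  have hp' : (3 / 2 : ℝ≥0∞) ≠ ⊤ := (ENNReal.div_lt_top (by simp) (by simp)).ne
  have htwo : 2 * (3 / 2) = (3 : ℝ≥0∞) := ENNReal.mul_div_cancel two_ne_zero ENNReal.ofNat_ne_top
  obtain ⟨C, hC⟩ := exists_eLpNorm_heatCurlPart_le hp hp'
  refine ⟨C, ?_⟩
  rintro A ⟨hA, B', hB', hAB'⟩ B hAB
  have hB : MemLp B (3 / 2) := hB'.ae_eq (hAB'.ae_eq hAB)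
  exact gaugeL3Seminorm_le_of_forall_eLpNorm_heatCurlPart_le hAB hA hp.le hp' hB
    fun ε T hε => by simpa only [htwo] using hC ε T hε B hB
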